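/- Let $t\in\mathbb{C}^*$, and let $AQ_t$ be the $t$-Alexander quandle: the set $\mathbb{C}$ with $a\triangleright b=tb+(1-t)a$. Let $\mathcal{T}$ be the category of oriented tangles: its objects are finite sequences $\epsilon$ of signs, and its morphisms are isotopy classes of tangles (diagrams composed of the elementary caps, cups and crossings, modulo planar isotopy and Reidemeister moves). For a tangle $T:\epsilon\to\varepsilon$ let $Q_T$ be its quandle (given by the Wirtinger presentation of a diagram), and let $Q_\epsilon$ be the free quandle on $|\epsilon|$ generators. Let $\mathcal{A}_t:\mathcal{T}\to\mathrm{Span}(\mathrm{Vect}_{\mathbb{C}})$ be the functor with $\mathcal{A}_t(\epsilon)=\mathrm{Hom}_{\mathrm{Qdl}}(Q_\epsilon,AQ_t)\cong\mathbb{C}^{|\epsilon|}$ that sends $T$ to the span of restriction maps $$\mathrm{Hom}(Q_\epsilon,AQ_t)\longleftarrow\mathrm{Hom}(Q_T,AQ_t)\longrightarrow\mathrm{Hom}(Q_\varepsilon,AQ_t).$$ Here $\mathrm{Span}(\mathrm{Vect}_{\mathbb{C}})$ is the category of finite-dimensional complex vector spaces and equivalence classes of spans, where two spans are equivalent if an isomorphism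 of their middle spaces intertwines the legs, and spans are composed by pullback. A span is called basic if it is equivalent to $V\xleftarrow{\ \mathrm{id}\ }V\xrightarrow{\ f\ }W$ for a linear map $f$; basic spans give an embedding $\mathrm{Vect}_{\mathbb{C}}\hookrightarrow\mathrm{Span}(\mathrm{Vect}_{\mathbb{C}})$ (finite-dimensional spaces). Let $\mathcal{B}$ be the category of braids: its objects are the numbers $n\ge 0$, $\mathrm{Hom}_{\mathcal{B}}(n,n)=\mathrm{B}_n$ is the Artin braid group with generators $e_1,\dots,e_{n-1}$, and $\mathrm{Hom}_{\mathcal{B}}(m,n)=\emptyset$ for $m\neq n$. It has the tensor product $m\otimes n=m+n$ given by juxtaposition and the braiding $c_{m,n}:m+n\to n+m$ that carries the first $m$ strands, as a parallel bundle, over the last $n$ strands. It is mapped to $\mathcal{T}$ by $n\mapsto(+,\dots,+)$ and $e_i\mapsto\mathrm{id}\otimes\cdots\otimes X_+\otimes\cdots\otimes\mathrm{id}$, where $X_+:(+,+)\to(+,+)$ is the positive crossing, for which $\mathcal{A}_t(X_+)$ is the basic span of $(a_1,a_2)\mapsto(a_1\triangleright a_2,\,a_1)$. Then: 1. For every braid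 $B$, i.e. every tangle between sequences of positive signs with a diagram in which all strands move upwards, the span $\mathcal{A}_t(B)$ is basic. The same holds for the tangle of every morphism of $\mathcal{B}$. 2. There is a unique functor $\mathcal{A}_t|_{\mathcal{B}}:\mathcal{B}\to\mathrm{Vect}_{\mathbb{C}}$ whose composite with the embedding $\mathrm{Vect}_{\mathbb{C}}\hookrightarrow\mathrm{Span}(\mathrm{Vect}_{\mathbb{C}})$ equals the composite $\mathcal{B}\to\mathcal{T}\xrightarrow{\mathcal{A}_t}\mathrm{Span}(\mathrm{Vect}_{\mathbb{C}})$. 3. In the identification $\mathcal{A}_t(n)=\mathbb{C}^n$ the functor $\mathcal{A}_t|_{\mathcal{B}}$ is monoidal with respect to $\oplus$, i.e. $\mathcal{A}_t(B\otimes B')=\mathcal{A}_t(B)\oplus\mathcal{A}_t(B')$, and it is braided: the maps $\beta_{m,n}=\mathcal{A}_t(c_{m,n}):\mathbb{C}^m\oplus\mathbb{C}^n\to\mathbb{C}^n\oplus\mathbb{C}^m$ are $$\beta_{m,n}(a,b)=\Big(\big(\textstyle\sum_{i=1}^{m}(1-t)t^{i-1}a_i+t^m b_j\big)_{1\le j\le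 n},\ a\Big),$$ and they are isomorphisms, natural with respect to the maps $\mathcal{A}_t(B)$ of braids $B$, and satisfy the two hexagon identities. 4. For every $n$, the induced group homomorphism $\mathrm{B}_n\to\mathrm{GL}_n(\mathbb{C})$, $B\mapsto\mathcal{A}_t(B)$, is the unreduced Burau representation: for $1\le i\le n-1$, $$\mathcal{A}_t(e_i)=\mathrm{Id}_{i-1}\oplus\begin{pmatrix}1-t&t\\1&0\end{pmatrix}\oplus\mathrm{Id}_{n-i-1}.$$ -/

import Mathlib

open CategoryTheory
open scoped Quandles

namespace TangleTQFT

/-! ### Presented quandles -/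

/-- Words in the two quandle operations: `act u v` stands for `u ▷ v` and `inv u v` for `v ◁ u`. -/
inductive QWord (X : Type) : Type
  | of (x : X) : QWord X
  | act (u v : QWord X) : QWord X
  | inv (u v : QWord X) : QWord X

namespace QWord

def map {X Y : Type} (f : X → Y) : QWord X → QWord Y
  | of x => of (f x)
  | act u v => act (u.map f) (v.map f)
  | inv u v => inv (u.map f) (v.map f)

/-- The value of a word in a quandle, for given values of the letters. -/
def eval {X Q : Type} [Quandle Q] (c : X → Q) : QWord X → Q
  | of x => c x
  | act u v => u.eval c ◃ v.eval c
  | inv u v => u.eval c ◃⁻¹ v.eval c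

theorem eval_map {X Y Q : Type} [Quandle Q] (f : X → Y) (c : Y → Q) (u : QWord X) :
    (u.map f).eval c = u.eval (c ∘ f) := by
  induction u with
  | of x => rfl
  | act u v hu hv => simp [map, eval, hu, hv]
  | inv u v hu hv => simp [map, eval, hu, hv]

/-- The smallest congruence that contains the relations `r` and the quandle axioms. -/
inductive Congr {X : Type} (r : QWord X → QWord X → Prop) : QWord X → QWord X → Prop
  | rel {u v : QWord X} : r u v → Congr r u v
  | refl (u : QWord X) : Congr r u u
  | symm {u v : QWord X} : Congr r u v → Congr r v u
  | trans {u v w : QWord X} : Congr r u v → Congr r v w → Congr r u w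
  | act {u u' v v' : QWord X} : Congr r u u' → Congr r v v' → Congr r (act u v) (act u' v')
  | inv {u u' v v' : QWord X} : Congr r u u' → Congr r v v' → Congr r (inv u v) (inv u' v')
  | idem (u : QWord X) : Congr r (QWord.act u u) u
  | act_inv (u v : QWord X) : Congr r (QWord.act u (QWord.inv u v)) v
  | inv_act (u v : QWord X) : Congr r (QWord.inv u (QWord.act u v)) v
  | distrib (u v w : QWord X) : Congr r (QWord.act u (QWord.act v w))
      (QWord.act (QWord.act u v) (QWord.act u w))

end QWord

def presSetoid {X : Type} (r : QWord X → QWord X → Prop) : Setoid (QWord X) where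
  r := QWord.Congr r
  iseqv := ⟨QWord.Congr.refl, QWord.Congr.symm, QWord.Congr.trans⟩

/-- The quandle `⟨X | r⟩` with generators `X` and relations `u = v` for `r u v`. -/
def PresentedQuandle {X : Type} (r : QWord X → QWord X → Prop) : Type :=
  Quotient (presSetoid r)

namespace PresentedQuandle

variable {X : Type} {r : QWord X → QWord X → Prop}

instance : Quandle (PresentedQuandle r) where
  act := Quotient.map₂ QWord.act fun _ _ h _ _ h' => QWord.Congr.act h h'
  invAct := Quotient.map₂ QWord.inv fun _ _ h _ _ h' => QWord.Congr.inv h h'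
  self_distrib := by
    rintro ⟨u⟩ ⟨v⟩ ⟨w⟩
    exact Quotient.sound (QWord.Congr.distrib u v w)
  left_inv := by
    rintro ⟨u⟩ ⟨v⟩
    exact Quotient.sound (QWord.Congr.inv_act u v)
  right_inv := by
    rintro ⟨u⟩ ⟨v⟩
    exact Quotient.sound (QWord.Congr.act_inv u v)
  fix := by
    rintro ⟨u⟩
    exact Quotient.sound (QWord.Congr.idem u)

def of (r : QWord X → QWord X → Prop) (x : X) : PresentedQuandle r :=
  Quotient.mk (presSetoid r) (QWord.of x)

theorem eval_congr {Q : Type} [Quandle Q] (c : X → Q)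
    (h : ∀ u v, r u v → u.eval c = v.eval c) {u v : QWord X} (huv : QWord.Congr r u v) :
    u.eval c = v.eval c := by
  induction huv with
  | rel h' => exact h _ _ h'
  | refl u => rfl
  | symm _ ih => exact ih.symm
  | trans _ _ ih ih' => exact ih.trans ih'
  | act _ _ ih ih' => simp [QWord.eval, ih, ih']
  | inv _ _ ih ih' => simp [QWord.eval, ih, ih']
  | idem u => simp [QWord.eval]
  | act_inv u v => simp [QWord.eval]
  | inv_act u v => simp [QWord.eval]
  | distrib u v w => exact Shelf.self_distrib

/-- The universal property: assigning to the generators elements of a quandle `Q` that satisfy the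
relations defines a quandle homomorphism. -/
def lift {Q : Type} [Quandle Q] (c : X → Q) (h : ∀ u v, r u v → u.eval c = v.eval c) :
    PresentedQuandle r →◃ Q where
  toFun := Quotient.lift (fun u => u.eval c) fun _ _ huv => eval_congr c h huv
  map_act' := by
    rintro ⟨u⟩ ⟨v⟩
    rfl

theorem hom_inv {Q Q' : Type} [Quandle Q] [Quandle Q'] (f : Q → Q')
    (hf : ∀ x y, f (x ◃ y) = f x ◃ f y) (x y : Q) : f (x ◃⁻¹ y) = f x ◃⁻¹ f y := by
  rw [← Rack.left_cancel (f x), ← hf]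
  simp

theorem hom_mk {Q : Type} [Quandle Q] (f : PresentedQuandle r → Q)
    (hf : ∀ x y, f (x ◃ y) = f x ◃ f y) (u : QWord X) :
    f (Quotient.mk (presSetoid r) u) = u.eval fun x => f (of r x) := by
  induction u with
  | of x => rfl
  | act u v hu hv =>
    simp only [QWord.eval, ← hu, ← hv]
    exact hf (Quotient.mk (presSetoid r) u) (Quotient.mk (presSetoid r) v)
  | inv u v hu hv =>
    simp only [QWord.eval, ← hu, ← hv]
    exact hom_inv f hf (Quotient.mk (presSetoid r) u) (Quotient.mk (presSetoid r) v)

theorem eval_of (u : QWord X) : u.eval (of r) = Quotient.mk (presSetoid r) u :=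
  (hom_mk (r := r) id (fun _ _ => rfl) u).symm

end PresentedQuandle

/-- The free quandle on a set. -/
abbrev FreeQuandle (X : Type) : Type := PresentedQuandle (fun _ _ : QWord X => False)

/-! ### Representations in the Alexander quandle -/

/-- The `t`-Alexander quandle: the set `ℂ` with
`a ▷ b = t b + (1 - t) a` and `b ◁ a = t⁻¹ b + (1 - t⁻¹) a`. -/
def AlexQuandle (_t : ℂˣ) : Type := ℂ

noncomputable section

namespace AlexQuandle

variable (t : ℂˣ)

instance : AddCommGroup (AlexQuandle t) := inferInstanceAs (AddCommGroup ℂ)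

instance : Module ℂ (AlexQuandle t) := inferInstanceAs (Module ℂ ℂ)

instance : Quandle (AlexQuandle t) where
  act a b := (t : ℂ) • b + (1 - (t : ℂ)) • a
  invAct a b := (t : ℂ)⁻¹ • b + (1 - (t : ℂ)⁻¹) • a
  self_distrib := by
    intro x y z
    module
  left_inv := by
    intro a b
    have h : (t : ℂ)⁻¹ * (t : ℂ) = 1 := inv_mul_cancel₀ t.ne_zero
    simp only [smul_add, smul_smul, mul_sub, mul_one, h]
    module
  right_inv := by
    intro a b
    have h : (t : ℂ) * (t : ℂ)⁻¹ = 1 := mul_inv_cancel₀ t.ne_zero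
    simp only [smul_add, smul_smul, mul_sub, mul_one, h]
    module
  fix := by
    intro a
    module

theorem act_eq (a b : AlexQuandle t) : a ◃ b = (t : ℂ) • b + (1 - (t : ℂ)) • a := rfl

theorem invAct_eq (a b : AlexQuandle t) : a ◃⁻¹ b = (t : ℂ)⁻¹ • b + (1 - (t : ℂ)⁻¹) • a := rfl

end AlexQuandle

/-- The quandle representation variety of `Q` in the `t`-Alexander quandle: the set of all quandle
homomorphisms, a complex vector space under pointwise operations. -/
def repVariety (t : ℂˣ) (Q : Type) [Quandle Q] : Submodule ℂ (Q → AlexQuandle t) where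
  carrier := {f | ∀ x y : Q, f (x ◃ y) = f x ◃ f y}
  add_mem' := by
    intro f g hf hg x y
    simp only [Pi.add_apply, hf x y, hg x y, AlexQuandle.act_eq]
    module
  zero_mem' := by
    intro x y
    simp
  smul_mem' := by
    intro c f hf x y
    simp only [Pi.smul_apply, hf x y, AlexQuandle.act_eq]
    module

/-- Restriction of representations along a quandle homomorphism. -/
def restrict (t : ℂˣ) {Q Q' : Type} [Quandle Q] [Quandle Q'] (φ : Q →◃ Q') :
    repVariety t Q' →ₗ[ℂ] repVariety t Q where
  toFun f := ⟨fun x => f.1 (φ x), fun x y => by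
    beta_reduce
    rw [φ.map_act]
    exact f.2 _ _⟩
  map_add' _ _ := rfl
  map_smul' _ _ := rfl

theorem restrict_apply (t : ℂˣ) {Q Q' : Type} [Quandle Q] [Quandle Q'] (φ : Q →◃ Q')
    (f : repVariety t Q') (x : Q) : (restrict t φ f).1 x = f.1 (φ x) := rfl

/-- The values of a representation of a presented quandle on the generators. -/
def evalGen (t : ℂˣ) {X : Type} (r : QWord X → QWord X → Prop) :
    repVariety t (PresentedQuandle r) →ₗ[ℂ] (X → AlexQuandle t) where
  toFun f x := f.1 (PresentedQuandle.of r x)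
  map_add' _ _ := rfl
  map_smul' _ _ := rfl

theorem evalGen_injective (t : ℂˣ) {X : Type} (r : QWord X → QWord X → Prop) :
    Function.Injective (evalGen t r) := by
  intro f g h
  apply Subtype.ext
  funext q
  obtain ⟨u, rfl⟩ := Quotient.exists_rep q
  rw [PresentedQuandle.hom_mk f.1 f.2, PresentedQuandle.hom_mk g.1 g.2]
  exact congrArg (fun c => u.eval c) h

theorem mem_range_evalGen (t : ℂˣ) {X : Type} (r : QWord X → QWord X → Prop) (c : X → AlexQuandle t) :
    (∃ f, evalGen t r f = c) ↔
      ∀ u v, r u v → u.eval c = v.eval c := by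
  constructor
  · rintro ⟨f, rfl⟩ u v huv
    have h : Quotient.mk (presSetoid r) u = Quotient.mk (presSetoid r) v :=
      Quotient.sound (QWord.Congr.rel huv)
    have hu := PresentedQuandle.hom_mk f.1 f.2 u
    have hv := PresentedQuandle.hom_mk f.1 f.2 v
    exact hu.symm.trans ((congrArg f.1 h).trans hv)
  · intro h
    exact ⟨⟨PresentedQuandle.lift c h, fun x y => ShelfHom.map_act _⟩, rfl⟩

instance (t : ℂˣ) : Module.Finite ℂ (AlexQuandle t) := inferInstanceAs (Module.Finite ℂ ℂ)

instance (t : ℂˣ) {X : Type} [Finite X] (r : QWord X → QWord X → Prop) :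
    Module.Finite ℂ (repVariety t (PresentedQuandle r)) :=
  Module.Finite.of_injective (evalGen t r) (evalGen_injective t r)

/-- The identification of the representation variety of the free quandle on `n` generators
with `ℂⁿ`, by the values on the generators. -/
def evalEquiv (t : ℂˣ) (X : Type) : repVariety t (FreeQuandle X) ≃ₗ[ℂ] (X → ℂ) :=
  LinearEquiv.ofBijective (M₂ := X → AlexQuandle t) (evalGen t _)
    ⟨evalGen_injective t _, fun c => (mem_range_evalGen t _ c).2 fun _ _ h => h.elim⟩

/-! ### Spans of finite-dimensional complex vector spaces -/

/-- A span `V ← apex → W` of linear maps. -/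
structure LinSpan (V W : FGModuleCat.{0} ℂ) where
  apex : FGModuleCat.{0} ℂ
  left : apex →ₗ[ℂ] V
  right : apex →ₗ[ℂ] W

namespace LinSpan

variable {U V W Y : FGModuleCat.{0} ℂ}

/-- Two spans are equivalent if an isomorphism of their middle spaces intertwines the legs. -/
def Equiv (s s' : LinSpan V W) : Prop :=
  ∃ φ : s.apex ≃ₗ[ℂ] s'.apex, (∀ z, s'.left (φ z) = s.left z) ∧ ∀ z, s'.right (φ z) = s.right z

theorem Equiv.refl (s : LinSpan V W) : Equiv s s :=
  ⟨LinearEquiv.refl ℂ _, fun _ => rfl, fun _ => rfl⟩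

theorem Equiv.symm {s s' : LinSpan V W} : Equiv s s' → Equiv s' s := by
  rintro ⟨φ, h, h'⟩
  exact ⟨φ.symm, fun z => by rw [← h, φ.apply_symm_apply],
    fun z => by rw [← h', φ.apply_symm_apply]⟩

theorem Equiv.trans {s s' s'' : LinSpan V W} : Equiv s s' → Equiv s' s'' → Equiv s s'' := by
  rintro ⟨φ, h, h'⟩ ⟨ψ, k, k'⟩
  exact ⟨φ.trans ψ, fun z => by simp [h, k], fun z => by simp [h', k']⟩

instance setoid (V W : FGModuleCat.{0} ℂ) : Setoid (LinSpan V W) :=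
  ⟨Equiv, Equiv.refl, Equiv.symm, Equiv.trans⟩

/-- The pullback `{(z, z') | s.right z = s'.left z'}`. -/
def pullback (s : LinSpan U V) (s' : LinSpan V W) : Submodule ℂ (s.apex × s'.apex) :=
  LinearMap.eqLocus (s.right ∘ₗ LinearMap.fst ℂ _ _) (s'.left ∘ₗ LinearMap.snd ℂ _ _)

theorem mem_pullback (s : LinSpan U V) (s' : LinSpan V W) (z : s.apex × s'.apex) :
    z ∈ pullback s s' ↔ s.right z.1 = s'.left z.2 := Iff.rfl

/-- Composition of spans, by pullback. -/
def comp (s : LinSpan U V) (s' : LinSpan V W) : LinSpan U W where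
  apex := FGModuleCat.of ℂ (pullback s s')
  left := s.left ∘ₗ LinearMap.fst ℂ _ _ ∘ₗ (pullback s s').subtype
  right := s'.right ∘ₗ LinearMap.snd ℂ _ _ ∘ₗ (pullback s s').subtype

/-- The basic span `V = V → W` of a linear map. -/
def basic (f : V →ₗ[ℂ] W) : LinSpan V W where
  apex := V
  left := LinearMap.id
  right := f

/-- A criterion for equivalence: a bijective linear map between the middle spaces. -/
theorem Equiv.of_bijective {s s' : LinSpan V W} (φ : s.apex →ₗ[ℂ] s'.apex)
    (hφ : Function.Bijective φ) (h : ∀ z, s'.left (φ z) = s.left z)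
    (h' : ∀ z, s'.right (φ z) = s.right z) : Equiv s s' :=
  ⟨LinearEquiv.ofBijective φ hφ, h, h'⟩

theorem comp_equiv {s₁ s₂ : LinSpan U V} {s₁' s₂' : LinSpan V W} :
    Equiv s₁ s₂ → Equiv s₁' s₂' → Equiv (comp s₁ s₁') (comp s₂ s₂') := by
  rintro ⟨φ, h, h'⟩ ⟨ψ, k, k'⟩
  let m : pullback s₁ s₁' →ₗ[ℂ] pullback s₂ s₂' :=
    ((φ.toLinearMap.prodMap ψ.toLinearMap) ∘ₗ (pullback s₁ s₁').subtype).codRestrict _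
      (fun z => by
        have hz := (mem_pullback _ _ _).1 z.2
        simp [mem_pullback, h', k, hz])
  refine Equiv.of_bijective (s := comp s₁ s₁') (s' := comp s₂ s₂') m ⟨?_, ?_⟩
    (fun z => h _) (fun z => k' _)
  · rintro ⟨⟨a, b⟩, hab⟩ ⟨⟨c, d⟩, hcd⟩ hm
    have hm' := congrArg Subtype.val hm
    simp only [m] at hm'
    have h1 := φ.injective (congrArg Prod.fst hm')
    have h2 := ψ.injective (congrArg Prod.snd hm')
    exact Subtype.ext (Prod.ext h1 h2)
  · rintro ⟨⟨a, b⟩, hab⟩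
    refine ⟨⟨(φ.symm a, ψ.symm b), ?_⟩, ?_⟩
    · rw [mem_pullback] at hab ⊢
      rw [← h', ← k]
      simpa using hab
    · exact Subtype.ext (Prod.ext (φ.apply_symm_apply a) (ψ.apply_symm_apply b))

theorem id_comp (s : LinSpan U V) : Equiv (comp (basic LinearMap.id) s) s := by
  refine Equiv.of_bijective (s := comp (basic LinearMap.id) s)
    (LinearMap.snd ℂ _ _ ∘ₗ (pullback (basic LinearMap.id) s).subtype) ⟨?_, ?_⟩ ?_ ?_
  · rintro ⟨⟨a, b⟩, hab⟩ ⟨⟨c, d⟩, hcd⟩ hm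
    have hm' : b = d := hm
    have h1 : a = s.left b := hab
    have h2 : c = s.left d := hcd
    subst hm' h1 h2
    rfl
  · intro b
    exact ⟨⟨(s.left b, b), rfl⟩, rfl⟩
  · rintro ⟨⟨a, b⟩, hab⟩
    exact Eq.symm hab
  · intro z
    rfl

theorem comp_id (s : LinSpan U V) : Equiv (comp s (basic LinearMap.id)) s := by
  refine Equiv.of_bijective (s := comp s (basic LinearMap.id))
    (LinearMap.fst ℂ _ _ ∘ₗ (pullback s (basic LinearMap.id)).subtype) ⟨?_, ?_⟩ ?_ ?_
  · rintro ⟨⟨a, b⟩, hab⟩ ⟨⟨c, d⟩, hcd⟩ hm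
    have hm' : a = c := hm
    have h1 : s.right a = b := hab
    have h2 : s.right c = d := hcd
    subst hm' h1 h2
    rfl
  · intro b
    exact ⟨⟨(b, s.right b), rfl⟩, rfl⟩
  · intro z
    rfl
  · rintro ⟨⟨a, b⟩, hab⟩
    exact hab

theorem assoc (s : LinSpan U V) (s' : LinSpan V W) (s'' : LinSpan W Y) :
    Equiv (comp (comp s s') s'') (comp s (comp s' s'')) := by
  let m : pullback (comp s s') s'' →ₗ[ℂ] pullback s (comp s' s'') :=
    { toFun := fun z => ⟨(z.1.1.1.1, ⟨(z.1.1.1.2, z.1.2), z.2⟩), z.1.1.2⟩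
      map_add' := fun _ _ => rfl
      map_smul' := fun _ _ => rfl }
  refine Equiv.of_bijective (s := comp (comp s s') s'') (s' := comp s (comp s' s'')) m ⟨?_, ?_⟩
    (fun z => rfl) (fun z => rfl)
  · rintro ⟨⟨⟨⟨a, b⟩, h1⟩, c⟩, h2⟩ ⟨⟨⟨⟨a', b'⟩, h1'⟩, c'⟩, h2'⟩ hm
    have hm' := congrArg Subtype.val hm
    have e1 : a = a' := congrArg Prod.fst hm'
    have e2 : (b, c) = (b', c') := congrArg Subtype.val (congrArg Prod.snd hm')
    obtain ⟨rfl, rfl⟩ := Prod.mk.inj e2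
    subst e1
    rfl
  · rintro ⟨⟨a, ⟨⟨b, c⟩, h1⟩⟩, h2⟩
    exact ⟨⟨(⟨(a, b), h2⟩, c), h1⟩, rfl⟩

theorem basic_comp (f : U →ₗ[ℂ] V) (g : V →ₗ[ℂ] W) :
    Equiv (comp (basic f) (basic g)) (basic (g ∘ₗ f)) := by
  refine Equiv.of_bijective (s := comp (basic f) (basic g)) (s' := basic (g ∘ₗ f))
    (LinearMap.fst ℂ _ _ ∘ₗ (pullback (basic f) (basic g)).subtype) ⟨?_, ?_⟩ ?_ ?_
  · rintro ⟨⟨a, b⟩, hab⟩ ⟨⟨c, d⟩, hcd⟩ hm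
    have hm' : a = c := hm
    have h1 : f a = b := hab
    have h2 : f c = d := hcd
    subst hm' h1 h2
    rfl
  · intro b
    exact ⟨⟨(b, f b), rfl⟩, rfl⟩
  · intro z
    rfl
  · rintro ⟨⟨a, b⟩, hab⟩
    exact congrArg g hab

theorem basic_injective {f g : V →ₗ[ℂ] W} (h : Equiv (basic f) (basic g)) : f = g := by
  obtain ⟨φ, h, h'⟩ := h
  apply LinearMap.ext
  intro z
  have h1 : φ z = z := h z
  have h2 : g (φ z) = f z := h' z
  rw [← h2, h1]

end LinSpan

/-- The category of spans of finite-dimensional complex vector spaces: its objects are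
finite-dimensional complex vector spaces and its morphisms are equivalence classes of spans. -/
structure SpanVect where
  space : FGModuleCat.{0} ℂ

namespace SpanVect

instance : Category SpanVect where
  Hom V W := Quotient (LinSpan.setoid V.space W.space)
  id V := Quotient.mk _ (LinSpan.basic LinearMap.id)
  comp := Quotient.map₂ LinSpan.comp fun _ _ h _ _ h' => LinSpan.comp_equiv h h'
  id_comp := by
    rintro _ _ ⟨s⟩
    exact Quotient.sound (LinSpan.id_comp s)
  comp_id := by
    rintro _ _ ⟨s⟩
    exact Quotient.sound (LinSpan.comp_id s)
  assoc := by
    rintro _ _ _ _ ⟨s⟩ ⟨s'⟩ ⟨s''⟩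
    exact Quotient.sound (LinSpan.assoc s s' s'')

/-- The class of a span. -/
def ofSpan {V W : SpanVect} (s : LinSpan V.space W.space) : V ⟶ W := Quotient.mk _ s

theorem ofSpan_comp {U V W : SpanVect} (s : LinSpan U.space V.space) (s' : LinSpan V.space W.space) :
    (ofSpan s : U ⟶ V) ≫ (ofSpan s' : V ⟶ W) = ofSpan (s.comp s') := rfl

theorem ofSpan_eq {U V : SpanVect} {s s' : LinSpan U.space V.space} (h : LinSpan.Equiv s s') :
    (ofSpan s : U ⟶ V) = ofSpan s' := Quotient.sound h

theorem equiv_of_ofSpan_eq {U V : SpanVect} {s s' : LinSpan U.space V.space}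
    (h : (ofSpan s : U ⟶ V) = ofSpan s') : LinSpan.Equiv s s' := Quotient.exact h

end SpanVect

/-- The embedding of vector spaces into spans of vector spaces by basic spans. -/
def basicSpan : FGModuleCat.{0} ℂ ⥤ SpanVect where
  obj V := ⟨V⟩
  map f := SpanVect.ofSpan (LinSpan.basic f.hom.hom)
  map_id _ := rfl
  map_comp f g := (SpanVect.ofSpan_eq (LinSpan.basic_comp f.hom.hom g.hom.hom)).symm

/-- A morphism of spans is basic if it is the class of the basic span of a linear map. -/
def IsBasic {V W : SpanVect} (s : V ⟶ W) : Prop :=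
  ∃ f : V.space ⟶ W.space, s = SpanVect.ofSpan (LinSpan.basic f.hom.hom)

theorem basicSpan_injective {V W : FGModuleCat.{0} ℂ} {f g : V ⟶ W}
    (h : basicSpan.map f = basicSpan.map g) : f = g :=
  FGModuleCat.hom_ext (LinSpan.basic_injective (SpanVect.equiv_of_ofSpan_eq h))

/-- A functor to spans all of whose values on morphisms are basic, as a functor to vector
spaces. -/
def factorBasic {C : Type} [Category.{0} C] (G : C ⥤ SpanVect)
    (h : ∀ {a b : C} (f : a ⟶ b), IsBasic (G.map f)) : C ⥤ FGModuleCat.{0} ℂ where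
  obj a := (G.obj a).space
  map f := (h f).choose
  map_id a := basicSpan_injective ((h (𝟙 a)).choose_spec.symm.trans (G.map_id a))
  map_comp f g := basicSpan_injective <| by
    refine (h (f ≫ g)).choose_spec.symm.trans ((G.map_comp f g).trans ?_)
    rw [basicSpan.map_comp]
    exact congrArg₂ (· ≫ ·) (h f).choose_spec (h g).choose_spec

/-! ### Tangle diagrams and their quandles -/

/-- The sign of a boundary point of a tangle. -/
inductive PtSign : Type
  | pos
  | neg

open PtSign

/-- The six elementary tangles: the caps `(+,-) → ∅` and `(-,+) → ∅`, the cups `∅ → (+,-)` and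
`∅ → (-,+)`, and the crossings `X₊, X₋ : (+,+) → (+,+)` of two upward strands. -/
inductive Elem : Type
  | capPN
  | capNP
  | cupPN
  | cupNP
  | crossPos
  | crossNeg

namespace Elem

def dom : Elem → List PtSign
  | capPN => [pos, neg]
  | capNP => [neg, pos]
  | cupPN => []
  | cupNP => []
  | crossPos => [pos, pos]
  | crossNeg => [pos, pos]

def cod : Elem → List PtSign
  | capPN => []
  | capNP => []
  | cupPN => [pos, neg]
  | cupNP => [neg, pos]
  | crossPos => [pos, pos]
  | crossNeg => [pos, pos]

end Elem

/-- A horizontal slice of a tangle diagram from `X` to `Y`: one elementary tangle, with vertical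
strands to its left and to its right. -/
structure Slice (X Y : List PtSign) : Type where
  left : List PtSign
  gen : Elem
  right : List PtSign
  dom_eq : X = left ++ gen.dom ++ right
  cod_eq : Y = left ++ gen.cod ++ right

instance : Quiver (List PtSign) := ⟨Slice⟩

/-- A tangle diagram from `X` to `Y`, as a sequence of slices from bottom to top. -/
abbrev Diagram (X Y : List PtSign) : Type := Quiver.Path X Y

/-- The Wirtinger relations of a slice, between the arcs at its bottom (`Sum.inl`) and the arcs at
its top (`Sum.inr`), numbered from left to right. -/
inductive Slice.Rel {X Y : List PtSign} (s : Slice X Y) :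
    QWord (Fin X.length ⊕ Fin Y.length) → QWord (Fin X.length ⊕ Fin Y.length) → Prop
  | left (p : Fin X.length) (q : Fin Y.length) (hp : p.val < s.left.length)
      (hq : q.val = p.val) :
      Slice.Rel s (.of (.inl p)) (.of (.inr q))
  | right (p : Fin X.length) (q : Fin Y.length)
      (hp : s.left.length + s.gen.dom.length ≤ p.val)
      (hq : q.val + s.gen.dom.length = p.val + s.gen.cod.length) :
      Slice.Rel s (.of (.inl p)) (.of (.inr q))
  | cap (p p' : Fin X.length) (hs : s.gen = .capPN ∨ s.gen = .capNP)
      (hp : p.val = s.left.length) (hp' : p'.val = s.left.length + 1) :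
      Slice.Rel s (.of (.inl p)) (.of (.inl p'))
  | cup (q q' : Fin Y.length) (hs : s.gen = .cupPN ∨ s.gen = .cupNP)
      (hq : q.val = s.left.length) (hq' : q'.val = s.left.length + 1) :
      Slice.Rel s (.of (.inr q)) (.of (.inr q'))
  | crossPos_under (p p' : Fin X.length) (q : Fin Y.length) (hs : s.gen = .crossPos)
      (hp : p.val = s.left.length) (hp' : p'.val = s.left.length + 1)
      (hq : q.val = s.left.length) :
      Slice.Rel s (.of (.inr q)) (.act (.of (.inl p)) (.of (.inl p')))
  | crossPos_over (p : Fin X.length) (q' : Fin Y.length) (hs : s.gen = .crossPos)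
      (hp : p.val = s.left.length) (hq' : q'.val = s.left.length + 1) :
      Slice.Rel s (.of (.inr q')) (.of (.inl p))
  | crossNeg_over (p' : Fin X.length) (q : Fin Y.length) (hs : s.gen = .crossNeg)
      (hp' : p'.val = s.left.length + 1) (hq : q.val = s.left.length) :
      Slice.Rel s (.of (.inr q)) (.of (.inl p'))
  | crossNeg_under (p p' : Fin X.length) (q' : Fin Y.length) (hs : s.gen = .crossNeg)
      (hp : p.val = s.left.length) (hp' : p'.val = s.left.length + 1)
      (hq' : q'.val = s.left.length + 1) :
      Slice.Rel s (.of (.inr q')) (.inv (.of (.inl p')) (.of (.inl p)))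

namespace Diagram

variable {X : List PtSign}

/-- The edges of a diagram: the segments into which the horizontal levels between the slices cut
its arcs. -/
def Edge : {Y : List PtSign} → Diagram X Y → Type
  | _, .nil => Fin X.length
  | Y, .cons D _ => Edge D ⊕ Fin Y.length

def bottom : {Y : List PtSign} → (D : Diagram X Y) → Fin X.length → Edge D
  | _, .nil => id
  | _, .cons D _ => fun i => Sum.inl (bottom D i)

def top : {Y : List PtSign} → (D : Diagram X Y) → Fin Y.length → Edge D
  | _, .nil => id
  | _, .cons _ _ => Sum.inr

/-- The Wirtinger relations of a diagram: those of all its slices. -/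
def Wirtinger : {Y : List PtSign} → (D : Diagram X Y) → QWord (Edge D) → QWord (Edge D) → Prop
  | _, .nil => fun _ _ => False
  | _, .cons D s => fun u v =>
      (∃ u' v', Wirtinger D u' v' ∧ u = u'.map Sum.inl ∧ v = v'.map Sum.inl) ∨
      (∃ u' v', Slice.Rel s u' v' ∧ u = u'.map (Sum.map (top D) id) ∧
        v = v'.map (Sum.map (top D) id))

/-- The quandle of the tangle with a given diagram, by its Wirtinger presentation. -/
abbrev Qdl {Y : List PtSign} (D : Diagram X Y) : Type := PresentedQuandle (Wirtinger D)

/-- The map to the quandle of a tangle from the quandle of its incoming boundary. -/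
def bottomHom {Y : List PtSign} (D : Diagram X Y) : FreeQuandle (Fin X.length) →◃ Qdl D :=
  PresentedQuandle.lift (fun i => PresentedQuandle.of _ (bottom D i)) fun _ _ h => h.elim

/-- The map to the quandle of a tangle from the quandle of its outgoing boundary. -/
def topHom {Y : List PtSign} (D : Diagram X Y) : FreeQuandle (Fin Y.length) →◃ Qdl D :=
  PresentedQuandle.lift (fun i => PresentedQuandle.of _ (top D i)) fun _ _ h => h.elim

theorem finite_edge : {Y : List PtSign} → (D : Diagram X Y) → Finite (Edge D)
  | _, .nil => inferInstanceAs (Finite (Fin X.length))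
  | Y, .cons D _ =>
    haveI := finite_edge D
    inferInstanceAs (Finite (Edge D ⊕ Fin Y.length))

instance {Y : List PtSign} (D : Diagram X Y) : Finite (Edge D) := finite_edge D

end Diagram

/-- The representation variety of the quandle of the plane punctured at the points `X`. -/
def boundaryRep (t : ℂˣ) (X : List PtSign) : FGModuleCat.{0} ℂ :=
  FGModuleCat.of ℂ (repVariety t (FreeQuandle (Fin X.length)))

/-- The span of representation varieties of a tangle diagram, with the restrictions to the incoming
and to the outgoing boundary as legs. -/
def alexSpan (t : ℂˣ) {X Y : List PtSign} (D : Diagram X Y) :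
    LinSpan (boundaryRep t X) (boundaryRep t Y) where
  apex := FGModuleCat.of ℂ (repVariety t D.Qdl)
  left := restrict t D.bottomHom
  right := restrict t D.topHom

/-! ### Functoriality of the span of a diagram -/

/-- The colors `x` (bottom) and `y` (top) satisfy the relations of a slice. -/
def SliceCol (t : ℂˣ) {X Y : List PtSign} (s : Slice X Y) (x : Fin X.length → AlexQuandle t)
    (y : Fin Y.length → AlexQuandle t) : Prop :=
  ∀ u v, s.Rel u v → u.eval (Sum.elim x y) = v.eval (Sum.elim x y)

/-- The colors of the edges of a diagram satisfy the Wirtinger relations. -/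
def IsCol (t : ℂˣ) {X Y : List PtSign} (D : Diagram X Y) (c : D.Edge → AlexQuandle t) : Prop :=
  ∀ u v, D.Wirtinger u v → u.eval c = v.eval c

theorem isCol_cons (t : ℂˣ) {X Y Z : List PtSign} (D : Diagram X Y) (s : Y ⟶ Z)
    (c : Diagram.Edge (Quiver.Path.cons D s) → AlexQuandle t) :
    IsCol t (Quiver.Path.cons D s) c ↔
      IsCol t D (fun e => c (Sum.inl e)) ∧
        SliceCol t s (fun i => c (Sum.inl (D.top i))) (fun i => c (Sum.inr i)) := by
  have key : ∀ u : QWord (Fin Y.length ⊕ Fin Z.length),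
      QWord.eval c (u.map (Sum.map D.top id) :) =
        u.eval (Sum.elim (fun i => c (Sum.inl (D.top i))) (fun i => c (Sum.inr i))) := by
    intro u
    refine (QWord.eval_map (Sum.map D.top id) c u).trans (congrArg (fun f => u.eval f) ?_)
    funext x
    cases x <;> rfl
  have key' : ∀ u : QWord (Diagram.Edge D),
      QWord.eval c (u.map Sum.inl :) = u.eval (fun e => c (Sum.inl e)) :=
    fun u => QWord.eval_map Sum.inl c u
  constructor
  · intro h
    exact ⟨fun u v huv => (key' u).symm.trans ((h _ _ (Or.inl ⟨u, v, huv, rfl, rfl⟩)).trans (key' v)),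
      fun u v huv => (key u).symm.trans ((h _ _ (Or.inr ⟨u, v, huv, rfl, rfl⟩)).trans (key v))⟩
  · rintro ⟨h, h'⟩ u v (⟨u', v', huv, rfl, rfl⟩ | ⟨u', v', huv, rfl, rfl⟩)
    · exact (key' u').trans ((h _ _ huv).trans (key' v').symm)
    · exact (key u').trans ((h' _ _ huv).trans (key v').symm)

theorem exists_rep_iff (t : ℂˣ) {X Y : List PtSign} (D : Diagram X Y)
    (c : D.Edge → AlexQuandle t) : (∃ f, evalGen t D.Wirtinger f = c) ↔ IsCol t D c :=
  mem_range_evalGen t _ c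

theorem left_eq_iff (t : ℂˣ) {X Y : List PtSign} (D : Diagram X Y)
    (f : repVariety t D.Qdl) (x : boundaryRep t X) :
    (alexSpan t D).left f = x ↔
      (fun i => evalGen t D.Wirtinger f (D.bottom i)) = evalEquiv t (Fin X.length) x :=
  (evalEquiv t (Fin X.length)).injective.eq_iff.symm

theorem right_eq_iff (t : ℂˣ) {X Y : List PtSign} (D : Diagram X Y)
    (f : repVariety t D.Qdl) (y : boundaryRep t Y) :
    (alexSpan t D).right f = y ↔
      (fun i => evalGen t D.Wirtinger f (D.top i)) = evalEquiv t (Fin Y.length) y :=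
  (evalEquiv t (Fin Y.length)).injective.eq_iff.symm

theorem alexSpan_nil (t : ℂˣ) (X : List PtSign) :
    LinSpan.Equiv (alexSpan t (Quiver.Path.nil : Diagram X X)) (LinSpan.basic LinearMap.id) := by
  refine ⟨LinearEquiv.refl ℂ _, fun z => ?_, fun z => ?_⟩
  · exact ((left_eq_iff t (Quiver.Path.nil : Diagram X X) z z).2 rfl).symm
  · exact ((right_eq_iff t (Quiver.Path.nil : Diagram X X) z z).2 rfl).symm

theorem alexSpan_cons (t : ℂˣ) {X Y Z : List PtSign} (D : Diagram X Y) (s : Y ⟶ Z) :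
    LinSpan.Equiv (alexSpan t (Quiver.Path.cons D s))
      ((alexSpan t D).comp (alexSpan t s.toPath)) := by
  have hof : ∀ u v, Diagram.Wirtinger (Quiver.Path.cons D s) u v →
      u.eval (PresentedQuandle.of (Diagram.Wirtinger (Quiver.Path.cons D s))) =
        v.eval (PresentedQuandle.of (Diagram.Wirtinger (Quiver.Path.cons D s))) := by
    intro u v h
    rw [PresentedQuandle.eval_of, PresentedQuandle.eval_of]
    exact Quotient.sound (.rel h)
  let i₁ : D.Qdl →◃ Diagram.Qdl (Quiver.Path.cons D s) :=
    PresentedQuandle.lift (fun e => PresentedQuandle.of _ (Sum.inl e)) fun u v huv =>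
      (QWord.eval_map Sum.inl _ u).symm.trans
        ((hof _ _ (Or.inl ⟨u, v, huv, rfl, rfl⟩)).trans (QWord.eval_map Sum.inl _ v))
  let g : Fin Y.length ⊕ Fin Z.length → Diagram.Edge (Quiver.Path.cons D s) :=
    Sum.map D.top id
  let i₂ : Diagram.Qdl s.toPath →◃ Diagram.Qdl (Quiver.Path.cons D s) :=
    PresentedQuandle.lift (fun e => PresentedQuandle.of _ (g e)) fun u v huv => by
      obtain ⟨u', v', h, rfl, rfl⟩ | ⟨u', v', h, rfl, rfl⟩ := huv
      · exact h.elim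
      · have key : ∀ u : QWord (Fin Y.length ⊕ Fin Z.length),
            QWord.eval (fun e => PresentedQuandle.of
              (Diagram.Wirtinger (Quiver.Path.cons D s)) (g e))
              (u.map (Sum.map (Diagram.top (Quiver.Path.nil : Diagram Y Y)) id) :) =
            QWord.eval (PresentedQuandle.of _) (u.map g) := by
          intro u
          refine (QWord.eval_map _ _ u).trans (Eq.trans ?_ (QWord.eval_map _ _ u).symm)
          refine congrArg (fun f => u.eval f) ?_
          funext e
          cases e <;> rfl
        exact (key u').trans ((hof _ _ (Or.inr ⟨u', v', h, rfl, rfl⟩)).trans (key v').symm)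
  let m : repVariety t (Diagram.Qdl (Quiver.Path.cons D s)) →ₗ[ℂ]
      LinSpan.pullback (alexSpan t D) (alexSpan t s.toPath) :=
    LinearMap.codRestrict _ ((restrict t i₁).prod (restrict t i₂)) fun f =>
      (right_eq_iff t D _ _).2 rfl
  refine LinSpan.Equiv.of_bijective (s := alexSpan t (Quiver.Path.cons D s))
    (s' := (alexSpan t D).comp (alexSpan t s.toPath)) m ⟨?_, ?_⟩ (fun z => ?_) (fun z => ?_)
  · intro f f' h
    have h0 := congrArg Subtype.val h
    have h1 : restrict t i₁ f = restrict t i₁ f' := congrArg Prod.fst h0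
    have h2 : restrict t i₂ f = restrict t i₂ f' := congrArg Prod.snd h0
    apply evalGen_injective
    funext e
    cases e with
    | inl e => exact congrArg (fun f : repVariety t D.Qdl => f.1 (PresentedQuandle.of _ e)) h1
    | inr e =>
      exact congrArg (fun f : repVariety t (Diagram.Qdl s.toPath) =>
        f.1 (PresentedQuandle.of _ (Sum.inr e))) h2
  · rintro ⟨⟨f, f'⟩, hff⟩
    have h0 := (right_eq_iff t D f _).1 hff
    have h1 := (exists_rep_iff t D _).1 ⟨f, rfl⟩
    have h2 := ((isCol_cons t (Quiver.Path.nil : Diagram Y Y) s _).1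
      ((exists_rep_iff t s.toPath _).1 ⟨f', rfl⟩)).2
    have h3 : SliceCol t s (fun i => evalGen t D.Wirtinger f (D.top i))
        (fun i => evalGen t (Diagram.Wirtinger s.toPath) f' (Sum.inr i)) := by
      have e : (fun i => evalGen t D.Wirtinger f (D.top i)) =
        fun i => evalGen t (Diagram.Wirtinger s.toPath) f' (Sum.inl i) := h0
      rw [e]
      exact h2
    obtain ⟨F, hF⟩ := (exists_rep_iff t (Quiver.Path.cons D s)
      (Sum.elim (evalGen t D.Wirtinger f)
        (fun i => evalGen t (Diagram.Wirtinger s.toPath) f' (Sum.inr i)))).2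
      ((isCol_cons t D s _).2 ⟨h1, h3⟩)
    refine ⟨F, Subtype.ext (Prod.ext ?_ ?_)⟩
    · apply evalGen_injective
      funext e
      exact congrFun hF (Sum.inl e)
    · apply evalGen_injective
      funext e
      cases e with
      | inl e => exact (congrFun hF (Sum.inl (D.top e))).trans (congrFun h0 e)
      | inr e => exact congrFun hF (Sum.inr e)
  · exact (left_eq_iff t D _ _).2 rfl
  · exact (right_eq_iff t s.toPath _ _).2 rfl

theorem alexSpan_comp (t : ℂˣ) {X Y Z : List PtSign} (D : Diagram X Y) (D' : Diagram Y Z) :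
    LinSpan.Equiv (alexSpan t (D.comp D')) ((alexSpan t D).comp (alexSpan t D')) := by
  induction D' with
  | nil =>
    exact ((LinSpan.comp_equiv (.refl _) (alexSpan_nil t Y)).trans (LinSpan.comp_id _)).symm
  | cons D' s ih =>
    refine (alexSpan_cons t (D.comp D') s).trans ?_
    refine (LinSpan.comp_equiv ih (.refl _)).trans ?_
    refine (LinSpan.assoc _ _ _).trans ?_
    exact LinSpan.comp_equiv (.refl _) (alexSpan_cons t D' s).symm

/-- The span of a diagram, as a functor on diagrams. -/
def alexDiagram (t : ℂˣ) : Paths (List PtSign) ⥤ SpanVect where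
  obj X := ⟨boundaryRep t X⟩
  map D := SpanVect.ofSpan (alexSpan t D)
  map_id X := SpanVect.ofSpan_eq (alexSpan_nil t X)
  map_comp D D' := SpanVect.ofSpan_eq (alexSpan_comp t D D')

/-! ### The category of tangles -/

/-- The diagram with a single slice. -/
def step (X Y l : List PtSign) (g : Elem) (r : List PtSign)
    (h : X = l ++ g.dom ++ r := by simp [Elem.dom])
    (h' : Y = l ++ g.cod ++ r := by simp [Elem.cod]) : Diagram X Y :=
  Quiver.Path.cons Quiver.Path.nil (⟨l, g, r, h, h'⟩ : Slice X Y)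

/-- Placing vertical strands to the left and to the right of a diagram. -/
def whisker (a b : List PtSign) : List PtSign ⥤q List PtSign where
  obj X := a ++ X ++ b
  map := fun {X Y} (s : Slice X Y) =>
    (⟨a ++ s.left, s.gen, s.right ++ b, by
        simpa using congrArg (fun L => a ++ L ++ b) s.dom_eq, by
        simpa using congrArg (fun L => a ++ L ++ b) s.cod_eq⟩ :
      Slice (a ++ X ++ b) (a ++ Y ++ b))

/-- The local moves between oriented tangle diagrams: straightening of a bent strand, the full
rotation of a crossing, and the Reidemeister moves. -/
inductive Move : ∀ {X Y : List PtSign}, Diagram X Y → Diagram X Y → Prop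
  | zigzag₁ : Move (X := [pos]) (Y := [pos])
      ((step [pos] [pos, neg, pos] [pos] .cupNP []).comp
        (step [pos, neg, pos] [pos] [] .capPN [pos]))
      .nil
  | zigzag₂ : Move (X := [pos]) (Y := [pos])
      ((step [pos] [pos, neg, pos] [] .cupPN [pos]).comp
        (step [pos, neg, pos] [pos] [pos] .capNP []))
      .nil
  | zigzag₃ : Move (X := [neg]) (Y := [neg])
      ((step [neg] [neg, pos, neg] [neg] .cupPN []).comp
        (step [neg, pos, neg] [neg] [] .capNP [neg]))
      .nil
  | zigzag₄ : Move (X := [neg]) (Y := [neg])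
      ((step [neg] [neg, pos, neg] [] .cupNP [neg]).comp
        (step [neg, pos, neg] [neg] [neg] .capPN []))
      .nil
  | rotate (x : Elem) (hd : x.dom = [pos, pos]) (hc : x.cod = [pos, pos]) :
      Move (X := [neg, neg]) (Y := [neg, neg])
      (((((step [neg, neg] [neg, neg, pos, neg] [neg, neg] .cupPN []).comp
        (step _ [neg, neg, pos, pos, neg, neg] [neg, neg, pos] .cupPN [neg])).comp
        (step _ [neg, neg, pos, pos, neg, neg] [neg, neg] x [neg, neg] (by simp [hd]) (by simp [hc]))).comp
        (step _ [neg, pos, neg, neg] [neg] .capNP [pos, neg, neg])).comp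
        (step _ [neg, neg] [] .capNP [neg, neg]))
      (((((step [neg, neg] [neg, pos, neg, neg] [] .cupNP [neg, neg]).comp
        (step _ [neg, neg, pos, pos, neg, neg] [neg] .cupNP [pos, neg, neg])).comp
        (step _ [neg, neg, pos, pos, neg, neg] [neg, neg] x [neg, neg] (by simp [hd]) (by simp [hc]))).comp
        (step _ [neg, neg, pos, neg] [neg, neg, pos] .capPN [neg])).comp
        (step _ [neg, neg] [neg, neg] .capPN []))
  | reidemeister₁_right (x : Elem) (hd : x.dom = [pos, pos]) (hc : x.cod = [pos, pos]) :
      Move (X := [pos]) (Y := [pos])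
      (((step [pos] [pos, pos, neg] [pos] .cupPN []).comp
        (step _ [pos, pos, neg] [] x [neg] (by simp [hd]) (by simp [hc]))).comp
        (step _ [pos] [pos] .capPN []))
      .nil
  | reidemeister₁_left (x : Elem) (hd : x.dom = [pos, pos]) (hc : x.cod = [pos, pos]) :
      Move (X := [pos]) (Y := [pos])
      (((step [pos] [neg, pos, pos] [] .cupNP [pos]).comp
        (step _ [neg, pos, pos] [neg] x [] (by simp [hd]) (by simp [hc]))).comp
        (step _ [pos] [] .capNP [pos]))
      .nil
  | reidemeister₂_posNeg : Move (X := [pos, pos]) (Y := [pos, pos])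
      ((step [pos, pos] [pos, pos] [] .crossPos []).comp
        (step _ [pos, pos] [] .crossNeg []))
      .nil
  | reidemeister₂_negPos : Move (X := [pos, pos]) (Y := [pos, pos])
      ((step [pos, pos] [pos, pos] [] .crossNeg []).comp
        (step _ [pos, pos] [] .crossPos []))
      .nil
  | reidemeister₂_antiparallel (x y : Elem)
      (hxy : (x = .crossPos ∧ y = .crossNeg) ∨ (x = .crossNeg ∧ y = .crossPos))
      (hd : x.dom = [pos, pos]) (hc : x.cod = [pos, pos])
      (hd' : y.dom = [pos, pos]) (hc' : y.cod = [pos, pos]) :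
      Move (X := [pos, neg]) (Y := [pos, neg])
      ((((((step [pos, neg] [neg, pos, pos, neg] [] .cupNP [pos, neg]).comp
        (step _ [neg, pos, pos, neg] [neg] x [neg] (by simp [hd]) (by simp [hc]))).comp
        (step _ [neg, pos] [neg, pos] .capPN [])).comp
        (step _ [neg, pos, pos, neg] [neg, pos] .cupPN [])).comp
        (step _ [neg, pos, pos, neg] [neg] y [neg] (by simp [hd']) (by simp [hc']))).comp
        (step _ [pos, neg] [] .capNP [pos, neg]))
      .nil
  | reidemeister₂_antiparallel' (x y : Elem)
      (hxy : (x = .crossPos ∧ y = .crossNeg) ∨ (x = .crossNeg ∧ y = .crossPos))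
      (hd : x.dom = [pos, pos]) (hc : x.cod = [pos, pos])
      (hd' : y.dom = [pos, pos]) (hc' : y.cod = [pos, pos]) :
      Move (X := [neg, pos]) (Y := [neg, pos])
      ((((((step [neg, pos] [neg, pos, pos, neg] [neg, pos] .cupPN []).comp
        (step _ [neg, pos, pos, neg] [neg] x [neg] (by simp [hd]) (by simp [hc]))).comp
        (step _ [pos, neg] [] .capNP [pos, neg])).comp
        (step _ [neg, pos, pos, neg] [] .cupNP [pos, neg])).comp
        (step _ [neg, pos, pos, neg] [neg] y [neg] (by simp [hd']) (by simp [hc']))).comp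
        (step _ [neg, pos] [neg, pos] .capPN []))
      .nil
  | reidemeister₃ : Move (X := [pos, pos, pos]) (Y := [pos, pos, pos])
      (((step [pos, pos, pos] [pos, pos, pos] [] .crossPos [pos]).comp
        (step _ [pos, pos, pos] [pos] .crossPos [])).comp
        (step _ [pos, pos, pos] [] .crossPos [pos]))
      (((step [pos, pos, pos] [pos, pos, pos] [pos] .crossPos []).comp
        (step _ [pos, pos, pos] [] .crossPos [pos])).comp
        (step _ [pos, pos, pos] [pos] .crossPos []))

/-- The relations that generate isotopy of tangle diagrams: the local moves, applied to a part of a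
diagram, and the exchange of the heights of two elementary tangles that lie side by side. -/
inductive Isotopy : ∀ ⦃X Y : Paths (List PtSign)⦄, (X ⟶ Y) → (X ⟶ Y) → Prop
  | move (a b : List PtSign) {X Y : List PtSign} {D D' : Diagram X Y} (h : Move D D') :
      Isotopy (X := a ++ X ++ b) (Y := a ++ Y ++ b)
        ((whisker a b).mapPath D) ((whisker a b).mapPath D')
  | exchange (a : List PtSign) (g : Elem) (m : List PtSign) (h : Elem) (b : List PtSign) :
      Isotopy (X := a ++ g.dom ++ m ++ h.dom ++ b) (Y := a ++ g.cod ++ m ++ h.cod ++ b)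
        ((step (a ++ g.dom ++ m ++ h.dom ++ b) (a ++ g.cod ++ m ++ h.dom ++ b)
            a g (m ++ h.dom ++ b) (by simp) (by simp)).comp
          (step _ (a ++ g.cod ++ m ++ h.cod ++ b) (a ++ g.cod ++ m) h b (by simp) (by simp)))
        ((step (a ++ g.dom ++ m ++ h.dom ++ b) (a ++ g.dom ++ m ++ h.cod ++ b)
            (a ++ g.dom ++ m) h b (by simp) (by simp)).comp
          (step _ (a ++ g.cod ++ m ++ h.cod ++ b) a g (m ++ h.cod ++ b) (by simp) (by simp)))

/-- Isotopy of tangle diagrams, as a relation on the morphisms of the category of diagrams. -/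
def isotopyRel : HomRel (Paths (List PtSign)) := fun _ _ D D' => Isotopy D D'

/-- The category of oriented tangles: its objects are the finite sequences of signs, and its
morphisms are the isotopy classes of tangles, that is, tangle diagrams modulo isotopies of diagrams
and Reidemeister moves. -/
abbrev Tangle : Type := CategoryTheory.Quotient isotopyRel

/-- The isotopy class of a tangle diagram. -/
def Tangle.ofDiagram {X Y : List PtSign} (D : Diagram X Y) : (⟨X⟩ : Tangle) ⟶ ⟨Y⟩ :=
  (CategoryTheory.Quotient.functor isotopyRel).map D

/-! ### Invariance of the span under isotopy -/

/-- The relation between the colors of the bottom and of the top of an elementary tangle. -/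
def GenRel (t : ℂˣ) : Elem → List ℂ → List ℂ → Prop
  | .capPN, x, y => ∃ z, x = [z, z] ∧ y = []
  | .capNP, x, y => ∃ z, x = [z, z] ∧ y = []
  | .cupPN, x, y => ∃ z, x = [] ∧ y = [z, z]
  | .cupNP, x, y => ∃ z, x = [] ∧ y = [z, z]
  | .crossPos, x, y => ∃ a b, x = [a, b] ∧ y = [t * b + (1 - t) * a, a]
  | .crossNeg, x, y => ∃ a b, x = [a, b] ∧ y = [b, (t : ℂ)⁻¹ * a + (1 - (t : ℂ)⁻¹) * b]

theorem GenRel.length {t : ℂˣ} {g : Elem} {x y : List ℂ} (h : GenRel t g x y) :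
    x.length = g.dom.length ∧ y.length = g.cod.length := by
  cases g <;> simp only [GenRel] at h
  case crossPos => obtain ⟨a, b, rfl, rfl⟩ := h; simp [Elem.dom, Elem.cod]
  case crossNeg => obtain ⟨a, b, rfl, rfl⟩ := h; simp [Elem.dom, Elem.cod]
  all_goals
    obtain ⟨a, rfl, rfl⟩ := h
    simp [Elem.dom, Elem.cod]

def SRel (t : ℂˣ) {X Y : List PtSign} (s : Slice X Y) (x y : List ℂ) : Prop :=
  ∃ u m m' v, u.length = s.left.length ∧ v.length = s.right.length ∧ GenRel t s.gen m m' ∧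
    x = u ++ m ++ v ∧ y = u ++ m' ++ v

theorem exists_split (x : List ℂ) (l d r : ℕ) (h : x.length = l + d + r) :
    ∃ u m v, u.length = l ∧ m.length = d ∧ v.length = r ∧ x = u ++ m ++ v :=
  ⟨x.take l, (x.drop l).take d, x.drop (l + d), by grind, by grind, by grind, by
    rw [List.append_assoc, ← List.drop_drop, List.take_append_drop, List.take_append_drop]⟩

theorem sliceCol_iff (t : ℂˣ) {X Y : List PtSign} (s : Slice X Y) (x : Fin X.length → ℂ)
    (y : Fin Y.length → ℂ) : SliceCol t s x y ↔ SRel t s (List.ofFn x) (List.ofFn y) := by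
  have hX : X.length = s.left.length + s.gen.dom.length + s.right.length := by
    have := congrArg List.length s.dom_eq
    simpa [add_assoc] using this
  have hY : Y.length = s.left.length + s.gen.cod.length + s.right.length := by
    have := congrArg List.length s.cod_eq
    simpa [add_assoc] using this
  constructor
  · intro h
    obtain ⟨u, m, v, hu, hm, hv, hx⟩ := exists_split (List.ofFn x) _ _ _ (by simpa using hX)
    obtain ⟨u', m', v', hu', hm', hv', hy⟩ := exists_split (List.ofFn y) _ _ _ (by simpa using hY)
    have hx' : ∀ p (hp : p < X.length), (u ++ m ++ v)[p]? = some (x ⟨p, hp⟩) := by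
      intro p hp
      rw [← hx]
      simp [hp]
    have hy' : ∀ p (hp : p < Y.length), (u' ++ m' ++ v')[p]? = some (y ⟨p, hp⟩) := by
      intro p hp
      rw [← hy]
      simp [hp]
    have huu : u = u' := by
      apply List.ext_getElem (by omega)
      intro i h1 h2
      have e : x ⟨i, by omega⟩ = y ⟨i, by omega⟩ :=
        h _ _ (.left ⟨i, by omega⟩ ⟨i, by omega⟩ (by simp; omega) rfl)
      have e1 := hx' i (by omega)
      have e2 := hy' i (by omega)
      grind
    have hvv : v = v' := by
      apply List.ext_getElem (by omega)
      intro i h1 h2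
      have e : x ⟨u.length + m.length + i, by omega⟩ = y ⟨u'.length + m'.length + i, by omega⟩ :=
        h _ _ (.right ⟨u.length + m.length + i, by omega⟩ ⟨u'.length + m'.length + i, by omega⟩
          (by simp; omega) (by simp; omega))
      have e1 := hx' (u.length + m.length + i) (by omega)
      have e2 := hy' (u'.length + m'.length + i) (by omega)
      grind
    subst huu hvv
    refine ⟨u, m, m', v, hu, hv, ?_, hx, hy⟩
    have hxm : ∀ i (hi : i < m.length), m[i] = x ⟨u.length + i, by omega⟩ := by
      intro i hi
      have := hx' (u.length + i) (by omega)
      grind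
    have hym : ∀ i (hi : i < m'.length), m'[i] = y ⟨u.length + i, by omega⟩ := by
      intro i hi
      have := hy' (u.length + i) (by omega)
      grind
    cases hgen : s.gen with
    | capPN =>
      rw [hgen] at hm hm' hX
      obtain ⟨a, b, rfl⟩ := List.length_eq_two.1 hm
      obtain rfl := List.length_eq_zero_iff.1 hm'
      have e : x ⟨u.length + 0, by grind⟩ = x ⟨u.length + 1, by grind⟩ :=
        h _ _ (.cap _ _ (by simp [hgen]) hu (by simp [hu]))
      exact ⟨a, by grind, rfl⟩
    | capNP =>
      rw [hgen] at hm hm' hX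
      obtain ⟨a, b, rfl⟩ := List.length_eq_two.1 hm
      obtain rfl := List.length_eq_zero_iff.1 hm'
      have e : x ⟨u.length + 0, by grind⟩ = x ⟨u.length + 1, by grind⟩ :=
        h _ _ (.cap _ _ (by simp [hgen]) hu (by simp [hu]))
      exact ⟨a, by grind, rfl⟩
    | cupPN =>
      rw [hgen] at hm hm' hY
      obtain ⟨a, b, rfl⟩ := List.length_eq_two.1 hm'
      obtain rfl := List.length_eq_zero_iff.1 hm
      have e : y ⟨u.length + 0, by grind⟩ = y ⟨u.length + 1, by grind⟩ :=
        h _ _ (.cup _ _ (by simp [hgen]) hu (by simp [hu]))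
      exact ⟨a, rfl, by grind⟩
    | cupNP =>
      rw [hgen] at hm hm' hY
      obtain ⟨a, b, rfl⟩ := List.length_eq_two.1 hm'
      obtain rfl := List.length_eq_zero_iff.1 hm
      have e : y ⟨u.length + 0, by grind⟩ = y ⟨u.length + 1, by grind⟩ :=
        h _ _ (.cup _ _ (by simp [hgen]) hu (by simp [hu]))
      exact ⟨a, rfl, by grind⟩
    | crossPos =>
      rw [hgen] at hm hm' hX hY
      obtain ⟨a, b, rfl⟩ := List.length_eq_two.1 hm
      obtain ⟨a', b', rfl⟩ := List.length_eq_two.1 hm'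
      have e1 : y ⟨u.length + 0, by grind⟩ =
          t * x ⟨u.length + 1, by grind⟩ + (1 - t) * x ⟨u.length + 0, by grind⟩ :=
        h _ _ (.crossPos_under _ _ _ hgen hu (by simp [hu]) hu)
      have e2 : y ⟨u.length + 1, by grind⟩ = x ⟨u.length + 0, by grind⟩ :=
        h _ _ (.crossPos_over _ _ hgen hu (by simp [hu]))
      exact ⟨a, b, rfl, by grind⟩
    | crossNeg =>
      rw [hgen] at hm hm' hX hY
      obtain ⟨a, b, rfl⟩ := List.length_eq_two.1 hm
      obtain ⟨a', b', rfl⟩ := List.length_eq_two.1 hm'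
      have e1 : y ⟨u.length + 1, by grind⟩ = (t : ℂ)⁻¹ * x ⟨u.length + 0, by grind⟩ +
          (1 - (t : ℂ)⁻¹) * x ⟨u.length + 1, by grind⟩ :=
        h _ _ (.crossNeg_under _ _ _ hgen hu (by simp [hu]) (by simp [hu]))
      have e2 : y ⟨u.length + 0, by grind⟩ = x ⟨u.length + 1, by grind⟩ :=
        h _ _ (.crossNeg_over _ _ hgen (by simp [hu]) hu)
      exact ⟨a, b, rfl, by grind⟩
  · rintro ⟨u, m, m', v, hu, hv, hg, hx, hy⟩ w w' hw
    have hl := hg.length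
    have hx' : ∀ p : Fin X.length, (u ++ m ++ v)[p.val]? = some (x p) := by
      intro p
      rw [← hx]
      simp
    have hy' : ∀ p : Fin Y.length, (u ++ m' ++ v)[p.val]? = some (y p) := by
      intro p
      rw [← hy]
      simp
    cases hw with
    | left p q hp hq =>
      have e1 := hx' p
      have e2 := hy' q
      show x p = y q
      grind
    | right p q hp hq =>
      have e1 := hx' p
      have e2 := hy' q
      show x p = y q
      grind
    | cap p p' hs hp hp' =>
      have e1 := hx' p
      have e2 := hx' p'
      show x p = x p'
      rcases hs with hs | hs <;>
      · rw [hs] at hg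
        obtain ⟨z, rfl, rfl⟩ := hg
        grind
    | cup q q' hs hq hq' =>
      have e1 := hy' q
      have e2 := hy' q'
      show y q = y q'
      rcases hs with hs | hs <;>
      · rw [hs] at hg
        obtain ⟨z, rfl, rfl⟩ := hg
        grind
    | crossPos_under p p' q hs hp hp' hq =>
      have e1 := hx' p
      have e2 := hx' p'
      have e3 := hy' q
      rw [hs] at hg
      obtain ⟨a, b, rfl, rfl⟩ := hg
      show y q = t * x p' + (1 - t) * x p
      grind
    | crossPos_over p q' hs hp hq' =>
      have e1 := hx' p
      have e3 := hy' q'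
      rw [hs] at hg
      obtain ⟨a, b, rfl, rfl⟩ := hg
      show y q' = x p
      grind
    | crossNeg_over p' q hs hp' hq =>
      have e1 := hx' p'
      have e3 := hy' q
      rw [hs] at hg
      obtain ⟨a, b, rfl, rfl⟩ := hg
      show y q = x p'
      grind
    | crossNeg_under p p' q' hs hp hp' hq' =>
      have e1 := hx' p
      have e2 := hx' p'
      have e3 := hy' q'
      rw [hs] at hg
      obtain ⟨a, b, rfl, rfl⟩ := hg
      show y q' = (t : ℂ)⁻¹ * x p + (1 - (t : ℂ)⁻¹) * x p'
      grind

/-- The relation between the colors of the bottom and of the top of a diagram. -/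
def LRel (t : ℂˣ) {X : List PtSign} : {Y : List PtSign} → Diagram X Y → List ℂ → List ℂ → Prop
  | _, .nil, x, y => x.length = X.length ∧ x = y
  | _, .cons D s, x, y => ∃ m, LRel t D x m ∧ SRel t s m y

/-- The colors of the bottom and of the top determine the colors of all levels. -/
def LDet (t : ℂˣ) {X : List PtSign} : {Y : List PtSign} → Diagram X Y → Prop
  | _, .nil => True
  | _, .cons D s => LDet t D ∧
      ∀ x m m' y, LRel t D x m → LRel t D x m' → SRel t s m y → SRel t s m' y → m = m'

theorem SRel.length {t : ℂˣ} {X Y : List PtSign} {s : Slice X Y} {x y : List ℂ}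
    (h : SRel t s x y) : x.length = X.length ∧ y.length = Y.length := by
  obtain ⟨u, m, m', v, hu, hv, hg, rfl, rfl⟩ := h
  have hX := congrArg List.length s.dom_eq
  have hY := congrArg List.length s.cod_eq
  have := hg.length
  simp only [List.length_append] at *
  omega

theorem LRel.length {t : ℂˣ} {X Y : List PtSign} {D : Diagram X Y} {x y : List ℂ}
    (h : LRel t D x y) : x.length = X.length ∧ y.length = Y.length := by
  induction D generalizing y with
  | nil =>
    obtain ⟨h, rfl⟩ := h
    exact ⟨h, h⟩
  | cons D s ih =>
    obtain ⟨m, h, h'⟩ := h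
    exact ⟨(ih h).1, (SRel.length h').2⟩

theorem lrel_of_isCol (t : ℂˣ) {X Y : List PtSign} (D : Diagram X Y)
    (c : D.Edge → AlexQuandle t) (h : IsCol t D c) :
    LRel t D (List.ofFn (n := X.length) (α := ℂ) fun i => c (D.bottom i))
      (List.ofFn (n := Y.length) (α := ℂ) fun i => c (D.top i)) := by
  induction D with
  | nil => exact ⟨List.length_ofFn, rfl⟩
  | cons D s ih =>
    obtain ⟨h1, h2⟩ := (isCol_cons t D s c).1 h
    exact ⟨_, ih _ h1, (sliceCol_iff t s _ _).1 h2⟩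

theorem exists_ofFn {n : ℕ} (x : List ℂ) (h : x.length = n) : ∃ f : Fin n → ℂ, List.ofFn f = x := by
  subst h
  exact ⟨fun i => x[i], List.ofFn_getElem⟩

theorem exists_isCol (t : ℂˣ) {X Y : List PtSign} (D : Diagram X Y) (x y : List ℂ)
    (h : LRel t D x y) : ∃ c : D.Edge → AlexQuandle t, IsCol t D c ∧
      (List.ofFn (n := X.length) (α := ℂ) fun i => c (D.bottom i)) = x ∧
      (List.ofFn (n := Y.length) (α := ℂ) fun i => c (D.top i)) = y := by
  induction D generalizing y with
  | nil =>
    obtain ⟨hl, rfl⟩ := h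
    obtain ⟨f, hf⟩ := exists_ofFn x hl
    exact ⟨f, fun _ _ h => h.elim, hf, hf⟩
  | cons D s ih =>
    obtain ⟨m, h1, h2⟩ := h
    obtain ⟨c, hc, hx, hm⟩ := ih m h1
    obtain ⟨f, hf⟩ := exists_ofFn y (SRel.length h2).2
    subst hm hf
    exact ⟨Sum.elim c f, (isCol_cons t D s _).2 ⟨hc, (sliceCol_iff t s _ _).2 h2⟩, hx, rfl⟩

theorem isCol_unique (t : ℂˣ) {X Y : List PtSign} (D : Diagram X Y) (hD : LDet t D)
    (c c' : D.Edge → AlexQuandle t) (hc : IsCol t D c) (hc' : IsCol t D c')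
    (hb : (fun i => c (Diagram.bottom D i)) = fun i => c' (Diagram.bottom D i))
    (ht : (fun i => c (D.top i)) = fun i => c' (D.top i)) : c = c' := by
  induction D with
  | nil => exact hb
  | cons D s ih =>
    obtain ⟨h1, h2⟩ := (isCol_cons t D s c).1 hc
    obtain ⟨h1', h2'⟩ := (isCol_cons t D s c').1 hc'
    have r1 := lrel_of_isCol t D _ h1
    have r1' := lrel_of_isCol t D _ h1'
    have r2 := (sliceCol_iff t s _ _).1 h2
    have r2' := (sliceCol_iff t s _ _).1 h2'
    have hb' : (fun i => c (Sum.inl (Diagram.bottom D i))) =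
        fun i => c' (Sum.inl (Diagram.bottom D i)) := hb
    have ht' : (fun i => c (Sum.inr i)) = fun i => c' (Sum.inr i) := ht
    have e := hD.2 _ _ _ _ r1 (by
      have := r1'
      rw [← hb'] at this
      exact this) r2 (by
      have := r2'
      rw [← ht'] at this
      exact this)
    have e' := ih hD.1 _ _ h1 h1' hb' (List.ofFn_injective e)
    funext i
    cases i with
    | inl i => exact congrFun e' i
    | inr i => exact congrFun ht' i

theorem alexSpan_equiv (t : ℂˣ) {X Y : List PtSign} (D D' : Diagram X Y) (hD : LDet t D)
    (hD' : LDet t D') (h : ∀ x y, LRel t D x y ↔ LRel t D' x y) :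
    LinSpan.Equiv (alexSpan t D) (alexSpan t D') := by
  have inj : ∀ E : Diagram X Y, LDet t E →
      Function.Injective ((alexSpan t E).left.prod (alexSpan t E).right) := by
    intro E hE f f' hff
    have h1 : (alexSpan t E).left f = (alexSpan t E).left f' := congrArg Prod.fst hff
    have h2 : (alexSpan t E).right f = (alexSpan t E).right f' := congrArg Prod.snd hff
    apply evalGen_injective
    refine isCol_unique t E hE _ _ ((exists_rep_iff t E _).1 ⟨f, rfl⟩)
      ((exists_rep_iff t E _).1 ⟨f', rfl⟩) ?_ ?_
    · exact ((left_eq_iff t E f _).1 h1).trans ((left_eq_iff t E f' _).1 rfl).symm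
    · exact ((right_eq_iff t E f _).1 h2).trans ((right_eq_iff t E f' _).1 rfl).symm
  have rng : ∀ E : Diagram X Y, ∀ z : boundaryRep t X × boundaryRep t Y,
      z ∈ LinearMap.range ((alexSpan t E).left.prod (alexSpan t E).right) ↔
        LRel t E (List.ofFn (evalEquiv t _ z.1)) (List.ofFn (evalEquiv t _ z.2)) := by
    intro E z
    constructor
    · rintro ⟨f, rfl⟩
      exact lrel_of_isCol t E _ ((exists_rep_iff t E _).1 ⟨f, rfl⟩)
    · intro hz
      obtain ⟨c, hc, h1, h2⟩ := exists_isCol t E _ _ hz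
      obtain ⟨f, rfl⟩ := (exists_rep_iff t E c).2 hc
      exact ⟨f, Prod.ext ((left_eq_iff t E f _).2 (List.ofFn_injective h1))
        ((right_eq_iff t E f _).2 (List.ofFn_injective h2))⟩
  have hr : LinearMap.range ((alexSpan t D).left.prod (alexSpan t D).right) =
      LinearMap.range ((alexSpan t D').left.prod (alexSpan t D').right) := by
    ext z
    rw [rng, rng, h]
  let e := (LinearEquiv.ofInjective _ (inj D hD)).trans
    ((LinearEquiv.ofEq _ _ hr).trans (LinearEquiv.ofInjective _ (inj D' hD')).symm)
  have he : ∀ z, ((alexSpan t D').left.prod (alexSpan t D').right) (e z) =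
      ((alexSpan t D).left.prod (alexSpan t D).right) z := by
    intro z
    have := congrArg Subtype.val ((LinearEquiv.ofInjective _ (inj D' hD')).apply_symm_apply
      (LinearEquiv.ofEq _ _ hr (LinearEquiv.ofInjective _ (inj D hD) z)))
    exact this
  exact ⟨e, fun z => congrArg Prod.fst (he z), fun z => congrArg Prod.snd (he z)⟩

theorem srel_whisker (t : ℂˣ) (a b : List PtSign) {X Y : List PtSign} (s : Slice X Y)
    (x y : List ℂ) : SRel t ((whisker a b).map s : Slice (a ++ X ++ b) (a ++ Y ++ b)) x y ↔
      ∃ u x' y' v, u.length = a.length ∧ v.length = b.length ∧ SRel t s x' y' ∧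
        x = u ++ x' ++ v ∧ y = u ++ y' ++ v := by
  constructor
  · rintro ⟨u, m, m', v, hu, hv, hg, rfl, rfl⟩
    have hu' : u.length = a.length + s.left.length := by simpa [whisker] using hu
    have hv' : v.length = s.right.length + b.length := by simpa [whisker] using hv
    refine ⟨u.take a.length, u.drop a.length ++ m ++ v.take s.right.length,
      u.drop a.length ++ m' ++ v.take s.right.length, v.drop s.right.length, ?_, ?_,
      ⟨u.drop a.length, m, m', v.take s.right.length, ?_, ?_, hg, rfl, rfl⟩, ?_, ?_⟩
    · simp [hu']
    · simp [hv']
    · simp [hu']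
    · simp [hv']
    · simp [← List.append_assoc, List.take_append_drop]
      simp [List.append_assoc, List.take_append_drop]
    · simp [← List.append_assoc, List.take_append_drop]
      simp [List.append_assoc, List.take_append_drop]
  · rintro ⟨u, x', y', v, hu, hv, ⟨u', m, m', v', hu', hv', hg, rfl, rfl⟩, rfl, rfl⟩
    refine ⟨u ++ u', m, m', v' ++ v, ?_, ?_, hg, ?_, ?_⟩
    · simp [whisker, hu, hu']
    · simp [whisker, hv, hv']
    · simp
    · simp

theorem lrel_whisker (t : ℂˣ) (a b : List PtSign) {X Y : List PtSign} (D : Diagram X Y)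
    (x y : List ℂ) : LRel t ((whisker a b).mapPath D : Diagram (a ++ X ++ b) (a ++ Y ++ b)) x y ↔
      ∃ u x' y' v, u.length = a.length ∧ v.length = b.length ∧ LRel t D x' y' ∧
        x = u ++ x' ++ v ∧ y = u ++ y' ++ v := by
  induction D generalizing y with
  | nil =>
    constructor
    · rintro ⟨h, rfl⟩
      obtain ⟨u, m, v, hu, hm, hv, rfl⟩ := exists_split x a.length X.length b.length (by
        simpa [whisker, add_assoc] using h)
      exact ⟨u, m, m, v, hu, hv, ⟨hm, rfl⟩, rfl, rfl⟩
    · rintro ⟨u, x', y', v, hu, hv, ⟨h, rfl⟩, rfl, rfl⟩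
      exact ⟨by simp [whisker, hu, hv, h], rfl⟩
  | cons D s ih =>
    constructor
    · rintro ⟨m, h, h'⟩
      obtain ⟨u, x', y', v, hu, hv, h1, rfl, rfl⟩ := (ih m).1 h
      obtain ⟨u₁, x₁, y₁, v₁, hu₁, hv₁, h1', e, rfl⟩ := (srel_whisker t a b s _ _).1 h'
      have hl := h1.length
      have hl' := h1'.length
      obtain ⟨e1, rfl⟩ := List.append_inj' e (by omega)
      obtain ⟨rfl, rfl⟩ := List.append_inj e1 (by omega)
      exact ⟨u, x', y₁, v, hu, hv, ⟨_, h1, h1'⟩, rfl, rfl⟩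
    · rintro ⟨u, x', y', v, hu, hv, ⟨m, h1, h2⟩, rfl, rfl⟩
      exact ⟨u ++ m ++ v, (ih _).2 ⟨u, x', m, v, hu, hv, h1, rfl, rfl⟩,
        (srel_whisker t a b s _ _).2 ⟨u, m, y', v, hu, hv, h2, rfl, rfl⟩⟩

theorem ldet_whisker (t : ℂˣ) (a b : List PtSign) {X Y : List PtSign} (D : Diagram X Y)
    (h : LDet t D) : LDet t ((whisker a b).mapPath D : Diagram (a ++ X ++ b) (a ++ Y ++ b)) := by
  induction D with
  | nil => trivial
  | cons D s ih =>
    refine ⟨ih h.1, ?_⟩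
    intro x m m' y h1 h2 h3 h4
    obtain ⟨u, x₁, m₁, v, hu, hv, r1, rfl, rfl⟩ := (lrel_whisker t a b D _ _).1 h1
    obtain ⟨u', x₂, m₂, v', hu', hv', r2, e, rfl⟩ := (lrel_whisker t a b D _ _).1 h2
    obtain ⟨e1, rfl⟩ := List.append_inj' e (by omega)
    obtain ⟨rfl, rfl⟩ := List.append_inj e1 (by omega)
    obtain ⟨u₃, x₃, y₃, v₃, hu₃, hv₃, r3, e3, rfl⟩ := (srel_whisker t a b s _ _).1 h3
    obtain ⟨u₄, x₄, y₄, v₄, hu₄, hv₄, r4, e4, e5⟩ := (srel_whisker t a b s _ _).1 h4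
    obtain ⟨e1, rfl⟩ := List.append_inj' e3 (by omega)
    obtain ⟨rfl, rfl⟩ := List.append_inj e1 (by omega)
    obtain ⟨e1, rfl⟩ := List.append_inj' e4 (by omega)
    obtain ⟨rfl, rfl⟩ := List.append_inj e1 (by omega)
    obtain ⟨e1, -⟩ := List.append_inj' e5 (by omega)
    obtain ⟨-, rfl⟩ := List.append_inj e1 (by omega)
    rw [h.2 _ _ _ _ r1 r2 r3 r4]

/-- The colors of the top of a slice, in terms of those of its bottom. -/
theorem srel_iff (t : ℂˣ) {X Y : List PtSign} (s : Slice X Y) (x y : List ℂ) :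
    SRel t s x y ↔ x.length = X.length ∧ ∃ m',
      GenRel t s.gen ((x.drop s.left.length).take s.gen.dom.length) m' ∧
        y = x.take s.left.length ++ m' ++ x.drop (s.left.length + s.gen.dom.length) := by
  constructor
  · intro h
    refine ⟨h.length.1, ?_⟩
    obtain ⟨u, m, m', v, hu, hv, hg, rfl, rfl⟩ := h
    have hl := hg.length.1
    refine ⟨m', ?_, ?_⟩
    · rw [← hu, ← hl, List.append_assoc, List.drop_left, List.take_left]
      exact hg
    · rw [← hu, ← hl, ← List.length_append, List.drop_left, List.append_assoc u m v,
        List.take_left]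
  · rintro ⟨hx, m', hg, rfl⟩
    have hX := congrArg List.length s.dom_eq
    rw [← hx] at hX
    obtain ⟨u, m, v, hu, hm, hv, rfl⟩ := exists_split x s.left.length s.gen.dom.length
      s.right.length (by rw [hX]; simp [add_assoc])
    refine ⟨u, m, m', v, hu, hv, ?_, rfl, ?_⟩
    · rwa [← hu, ← hm, List.append_assoc, List.drop_left, List.take_left] at hg
    · rw [← hu, ← hm, ← List.length_append, List.drop_left, List.append_assoc u m v,
        List.take_left]

theorem lrel_comp_step (t : ℂˣ) {X Y Z : List PtSign} (D : Diagram X Y) (l : List PtSign)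
    (g : Elem) (r : List PtSign) (h : Y = l ++ g.dom ++ r) (h' : Z = l ++ g.cod ++ r)
    (x y : List ℂ) : LRel t (D.comp (step Y Z l g r h h')) x y ↔
      ∃ m, LRel t D x m ∧ (m.length = Y.length ∧ ∃ m',
        GenRel t g ((m.drop l.length).take g.dom.length) m' ∧
          y = m.take l.length ++ m' ++ m.drop (l.length + g.dom.length)) :=
  exists_congr fun m => and_congr_right fun _ => srel_iff t ⟨l, g, r, h, h'⟩ m y

theorem lrel_nil (t : ℂˣ) {X : List PtSign} (x y : List ℂ) :
    LRel t (Quiver.Path.nil : Diagram X X) x y ↔ x.length = X.length ∧ x = y := Iff.rfl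

theorem lrel_step (t : ℂˣ) {X Y : List PtSign} (l : List PtSign)
    (g : Elem) (r : List PtSign) (h : X = l ++ g.dom ++ r) (h' : Y = l ++ g.cod ++ r)
    (x y : List ℂ) : LRel t (step X Y l g r h h') x y ↔
      x.length = X.length ∧ ∃ m',
        GenRel t g ((x.drop l.length).take g.dom.length) m' ∧
          y = x.take l.length ++ m' ++ x.drop (l.length + g.dom.length) := by
  rw [← srel_iff t ⟨l, g, r, h, h'⟩]
  constructor
  · rintro ⟨m, ⟨-, rfl⟩, h⟩
    exact h
  · intro h
    exact ⟨x, ⟨h.length.1, rfl⟩, h⟩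

theorem ldet_nil (t : ℂˣ) {X : List PtSign} : LDet t (Quiver.Path.nil : Diagram X X) := trivial

theorem ldet_step (t : ℂˣ) {X Y : List PtSign} (l : List PtSign)
    (g : Elem) (r : List PtSign) (h : X = l ++ g.dom ++ r) (h' : Y = l ++ g.cod ++ r) :
    LDet t (step X Y l g r h h') :=
  ⟨trivial, fun _ _ _ _ h1 h2 _ _ => h1.2.symm.trans h2.2⟩

theorem ldet_cap (t : ℂˣ) {X Y Z : List PtSign} (D : Diagram X Y) (l : List PtSign)
    (g : Elem) (r : List PtSign) (h : Y = l ++ g.dom ++ r) (h' : Z = l ++ g.cod ++ r)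
    (hD : LDet t D)
    (H : ∀ x m₁ m₂ m' y, x.length = X.length → LRel t D x m₁ → LRel t D x m₂ →
        GenRel t g ((m₁.drop l.length).take g.dom.length) m' →
          y = m₁.take l.length ++ m' ++ m₁.drop (l.length + g.dom.length) → ∀ m'',
        GenRel t g ((m₂.drop l.length).take g.dom.length) m'' →
          y = m₂.take l.length ++ m'' ++ m₂.drop (l.length + g.dom.length) → m₁ = m₂) :
    LDet t (D.comp (step Y Z l g r h h')) := by
  refine ⟨hD, fun x m₁ m₂ y h1 h2 h3 h4 => ?_⟩
  obtain ⟨-, m', h5, h6⟩ := (srel_iff t (⟨l, g, r, h, h'⟩ : Slice Y Z) m₁ y).1 h3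
  obtain ⟨-, m'', h7, h8⟩ := (srel_iff t (⟨l, g, r, h, h'⟩ : Slice Y Z) m₂ y).1 h4
  exact H x m₁ m₂ m' y h1.length.1 h1 h2 h5 h6 m'' h7 h8

theorem GenRel.injective {t : ℂˣ} {g : Elem} (h1 : g ≠ .capPN) (h2 : g ≠ .capNP)
    {x x' y : List ℂ} (h : GenRel t g x y) (h' : GenRel t g x' y) : x = x' := by
  have ht : (t : ℂ) * (t : ℂ)⁻¹ = 1 := mul_inv_cancel₀ t.ne_zero
  cases g with
  | capPN => exact absurd rfl h1
  | capNP => exact absurd rfl h2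
  | cupPN =>
    obtain ⟨z, rfl, rfl⟩ := h
    obtain ⟨z', rfl, h⟩ := h'
    rfl
  | cupNP =>
    obtain ⟨z, rfl, rfl⟩ := h
    obtain ⟨z', rfl, h⟩ := h'
    rfl
  | crossPos =>
    obtain ⟨a, b, rfl, rfl⟩ := h
    obtain ⟨a', b', rfl, h⟩ := h'
    grind
  | crossNeg =>
    obtain ⟨a, b, rfl, rfl⟩ := h
    obtain ⟨a', b', rfl, h⟩ := h'
    grind

theorem ldet_comp_step (t : ℂˣ) {X Y Z : List PtSign} (D : Diagram X Y) (l : List PtSign)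
    (g : Elem) (r : List PtSign) (h : Y = l ++ g.dom ++ r) (h' : Z = l ++ g.cod ++ r)
    (hD : LDet t D) (h1 : g ≠ .capPN) (h2 : g ≠ .capNP) :
    LDet t (D.comp (step Y Z l g r h h')) := by
  refine ⟨hD, fun x m₁ m₂ y _ _ h3 h4 => ?_⟩
  obtain ⟨u, m, m', v, hu, hv, hg, rfl, rfl⟩ := h3
  obtain ⟨u₁, m₁, m₁', v₁, hu₁, hv₁, hg₁, rfl, e⟩ := h4
  obtain ⟨e1, rfl⟩ := List.append_inj' e (by omega)
  obtain ⟨rfl, rfl⟩ := List.append_inj e1 (by omega)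
  rw [hg.injective h1 h2 hg₁]

theorem gen_calc (t : ℂˣ) :
    (∀ (a b : ℂ) (y : List ℂ), GenRel t .capPN [a, b] y ↔ b = a ∧ y = []) ∧
    (∀ (a b : ℂ) (y : List ℂ), GenRel t .capNP [a, b] y ↔ b = a ∧ y = []) ∧
    (∀ y : List ℂ, GenRel t .cupPN [] y ↔ ∃ z, y = [z, z]) ∧
    (∀ y : List ℂ, GenRel t .cupNP [] y ↔ ∃ z, y = [z, z]) ∧
    (∀ (a b : ℂ) (y : List ℂ), GenRel t .crossPos [a, b] y ↔ y = [t * b + (1 - t) * a, a]) ∧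
    (∀ (a b : ℂ) (y : List ℂ), GenRel t .crossNeg [a, b] y ↔
      y = [b, (t : ℂ)⁻¹ * a + (1 - (t : ℂ)⁻¹) * b]) ∧
    Elem.capPN.dom.length = 2 ∧ Elem.capNP.dom.length = 2 ∧ Elem.cupPN.dom.length = 0 ∧
    Elem.cupNP.dom.length = 0 ∧ Elem.crossPos.dom.length = 2 ∧ Elem.crossNeg.dom.length = 2 := by
  simp [GenRel, Elem.dom]

theorem list_calc {α : Type} :
    (∀ (a : α) (l : List α), (a :: l).length = l.length + 1) ∧ ([] : List α).length = 0 ∧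
    (∀ (n : ℕ) (a : α) (l : List α), (a :: l).drop (n + 1) = l.drop n) ∧
    (∀ n : ℕ, ([] : List α).drop n = []) ∧ (∀ n : ℕ, ([] : List α).take n = []) ∧
    (∀ (n : ℕ) (a : α) (l : List α), (a :: l).take (n + 1) = a :: l.take n) ∧
    (∀ (a : α) (l l' : List α), a :: l ++ l' = a :: (l ++ l')) ∧ (∀ l : List α, [] ++ l = l) ∧
    (∀ l : List α, l ++ [] = l) ∧ (∀ l : List α, l.drop 0 = l) ∧ (∀ l : List α, l.take 0 = []) ∧
    (∀ (a b : α) (l l' : List α), (a :: l = b :: l') = (a = b ∧ l = l')) ∧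
    (∀ (a : α) (l : List α), ([] = a :: l) = False) ∧
    (∀ (a : α) (l : List α), (a :: l = []) = False) ∧
    (∀ n : ℕ, 0 + n = n) ∧ (∀ n : ℕ, n + 0 = n) := by
  simp

theorem prop_calc : (∀ p, (True ∧ p) = p) ∧ (∀ p, (p ∧ True) = p) ∧ (∀ p, (p ∧ False) = False) ∧
    (∀ p, (p ∧ p) = p) ∧ (∀ a b c : Prop, (a ∧ b → c) = (a → b → c)) := by
  simp


set_option linter.unusedSimpArgs false in
set_option maxHeartbeats 2000000 in
theorem move_aux (t : ℂˣ) {X Y : List PtSign} {D D' : Diagram X Y} (h : Move D D') :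
    LDet t D ∧ LDet t D' ∧ ∀ x y, x.length = X.length → (LRel t D x y ↔ LRel t D' x y) := by
  have ht : (t : ℂ) * (t : ℂ)⁻¹ = 1 := mul_inv_cancel₀ t.ne_zero
  cases h with
  | zigzag₁ | zigzag₂ | zigzag₃ | zigzag₄ =>
    generalize_proofs
    refine ⟨?_, ldet_nil t, ?_⟩
    · apply ldet_cap
      · apply ldet_step
      · intro x m₁ m₂ m' y hx h1 h2
        obtain ⟨a, rfl⟩ := List.length_eq_one_iff.1 hx
        simp only [lrel_comp_step, lrel_step, lrel_nil] at h1 h2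
        simp only [gen_calc t, list_calc, existsAndEq, prop_calc, Nat.reduceAdd, Nat.reduceEqDiff, Nat.add_one_sub_one] at h1 h2
        obtain ⟨z, rfl⟩ := h1
        obtain ⟨z', rfl⟩ := h2
        simp only [gen_calc t, list_calc, existsAndEq, prop_calc, Nat.reduceAdd, Nat.reduceEqDiff, Nat.add_one_sub_one]
        grind
    · intro x y hx
      obtain ⟨a, rfl⟩ := List.length_eq_one_iff.1 hx
      simp only [lrel_comp_step, lrel_step, lrel_nil]
      simp only [gen_calc t, list_calc, existsAndEq, prop_calc, Nat.reduceAdd, Nat.reduceEqDiff, Nat.add_one_sub_one]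
      grind
  | reidemeister₂_posNeg | reidemeister₂_negPos =>
    generalize_proofs
    refine ⟨?_, ldet_nil t, ?_⟩
    · apply ldet_comp_step
      · apply ldet_step
      · simp
      · simp
    · intro x y hx
      obtain ⟨a, b, rfl⟩ := List.length_eq_two.1 hx
      simp only [lrel_comp_step, lrel_step, lrel_nil]
      simp only [gen_calc t, list_calc, existsAndEq, prop_calc, Nat.reduceAdd, Nat.reduceEqDiff, Nat.add_one_sub_one]
      grind
  | reidemeister₃ =>
    generalize_proofs
    refine ⟨?_, ?_, ?_⟩
    · repeat' first | apply ldet_comp_step | apply ldet_step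
      all_goals simp
    · repeat' first | apply ldet_comp_step | apply ldet_step
      all_goals simp
    · intro x y hx
      obtain ⟨a, b, c, rfl⟩ := List.length_eq_three.1 hx
      simp only [lrel_comp_step, lrel_step, lrel_nil]
      simp only [gen_calc t, list_calc, existsAndEq, prop_calc, Nat.reduceAdd, Nat.reduceEqDiff, Nat.add_one_sub_one]
      grind
  | reidemeister₁_right x hd hc =>
    cases x <;> try simp [Elem.dom] at hd
    all_goals
      generalize_proofs
      refine ⟨?_, ldet_nil t, ?_⟩
      · apply ldet_cap
        · repeat' first | apply ldet_comp_step | apply ldet_step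
          all_goals simp
        · intro x m₁ m₂ m' y hx h1 h2
          obtain ⟨a, rfl⟩ := List.length_eq_one_iff.1 hx
          simp only [lrel_comp_step, lrel_step, lrel_nil] at h1 h2
          simp only [gen_calc t, list_calc, existsAndEq, prop_calc, Nat.reduceAdd, Nat.reduceEqDiff, Nat.add_one_sub_one] at h1 h2
          obtain ⟨z, rfl⟩ := h1
          obtain ⟨z', rfl⟩ := h2
          simp only [gen_calc t, list_calc, existsAndEq, prop_calc, Nat.reduceAdd, Nat.reduceEqDiff, Nat.add_one_sub_one]
          grind
      · intro x y hx
        obtain ⟨a, rfl⟩ := List.length_eq_one_iff.1 hx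
        simp only [lrel_comp_step, lrel_step, lrel_nil]
        simp only [gen_calc t, list_calc, existsAndEq, prop_calc, Nat.reduceAdd, Nat.reduceEqDiff, Nat.add_one_sub_one]
        grind
  | reidemeister₁_left x hd hc =>
    cases x <;> try simp [Elem.dom] at hd
    all_goals
      generalize_proofs
      refine ⟨?_, ldet_nil t, ?_⟩
      · apply ldet_cap
        · repeat' first | apply ldet_comp_step | apply ldet_step
          all_goals simp
        · intro x m₁ m₂ m' y hx h1 h2
          obtain ⟨a, rfl⟩ := List.length_eq_one_iff.1 hx
          simp only [lrel_comp_step, lrel_step, lrel_nil] at h1 h2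
          simp only [gen_calc t, list_calc, existsAndEq, prop_calc, Nat.reduceAdd, Nat.reduceEqDiff, Nat.add_one_sub_one] at h1 h2
          obtain ⟨z, rfl⟩ := h1
          obtain ⟨z', rfl⟩ := h2
          simp only [gen_calc t, list_calc, existsAndEq, prop_calc, Nat.reduceAdd, Nat.reduceEqDiff, Nat.add_one_sub_one]
          grind
      · intro x y hx
        obtain ⟨a, rfl⟩ := List.length_eq_one_iff.1 hx
        simp only [lrel_comp_step, lrel_step, lrel_nil]
        simp only [gen_calc t, list_calc, existsAndEq, prop_calc, Nat.reduceAdd, Nat.reduceEqDiff, Nat.add_one_sub_one]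
        grind
  | reidemeister₂_antiparallel x y hxy hd hc hd' hc' =>
    obtain ⟨rfl, rfl⟩ | ⟨rfl, rfl⟩ := hxy
    all_goals
      generalize_proofs
      refine ⟨?_, ldet_nil t, ?_⟩
      · apply ldet_cap
        · apply ldet_comp_step _ _ _ _ _ _ _ _ (by simp) (by simp)
          apply ldet_comp_step _ _ _ _ _ _ _ _ (by simp) (by simp)
          apply ldet_cap
          · apply ldet_comp_step _ _ _ _ _ _ _ _ (by simp) (by simp)
            apply ldet_step
          · intro x m₁ m₂ m' y hx h1 h2
            obtain ⟨a, b, rfl⟩ := List.length_eq_two.1 hx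
            simp only [lrel_comp_step, lrel_step, lrel_nil] at h1 h2
            simp only [gen_calc t, list_calc, existsAndEq, prop_calc, Nat.reduceAdd, Nat.reduceEqDiff, Nat.add_one_sub_one] at h1 h2
            obtain ⟨z, rfl⟩ := h1
            obtain ⟨z', rfl⟩ := h2
            simp only [gen_calc t, list_calc, existsAndEq, prop_calc, Nat.reduceAdd, Nat.reduceEqDiff, Nat.add_one_sub_one]
            grind
        · intro x m₁ m₂ m' y hx h1 h2
          obtain ⟨a, b, rfl⟩ := List.length_eq_two.1 hx
          simp only [lrel_comp_step, lrel_step, lrel_nil] at h1 h2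
          simp only [gen_calc t, list_calc, existsAndEq, prop_calc, Nat.reduceAdd, Nat.reduceEqDiff, Nat.add_one_sub_one] at h1 h2
          first
            | obtain ⟨z, rfl⟩ := h1
              obtain ⟨z', rfl⟩ := h2
              simp only [gen_calc t, list_calc, existsAndEq, prop_calc, Nat.reduceAdd, Nat.reduceEqDiff, Nat.add_one_sub_one]
              grind
            | obtain ⟨z, hz, w, rfl⟩ := h1
              obtain ⟨z', hz', w', rfl⟩ := h2
              simp only [gen_calc t, list_calc, existsAndEq, prop_calc, Nat.reduceAdd, Nat.reduceEqDiff, Nat.add_one_sub_one]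
              grind
      · intro x y hx
        obtain ⟨a, b, rfl⟩ := List.length_eq_two.1 hx
        simp only [lrel_comp_step, lrel_step, lrel_nil]
        simp only [gen_calc t, list_calc, existsAndEq, prop_calc, Nat.reduceAdd, Nat.reduceEqDiff, Nat.add_one_sub_one]
        grind
  | reidemeister₂_antiparallel' x y hxy hd hc hd' hc' =>
    obtain ⟨rfl, rfl⟩ | ⟨rfl, rfl⟩ := hxy
    all_goals
      generalize_proofs
      refine ⟨?_, ldet_nil t, ?_⟩
      · apply ldet_cap
        · apply ldet_comp_step _ _ _ _ _ _ _ _ (by simp) (by simp)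
          apply ldet_comp_step _ _ _ _ _ _ _ _ (by simp) (by simp)
          apply ldet_cap
          · apply ldet_comp_step _ _ _ _ _ _ _ _ (by simp) (by simp)
            apply ldet_step
          · intro x m₁ m₂ m' y hx h1 h2
            obtain ⟨a, b, rfl⟩ := List.length_eq_two.1 hx
            simp only [lrel_comp_step, lrel_step, lrel_nil] at h1 h2
            simp only [gen_calc t, list_calc, existsAndEq, prop_calc, Nat.reduceAdd, Nat.reduceEqDiff, Nat.add_one_sub_one] at h1 h2
            obtain ⟨z, rfl⟩ := h1
            obtain ⟨z', rfl⟩ := h2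
            simp only [gen_calc t, list_calc, existsAndEq, prop_calc, Nat.reduceAdd, Nat.reduceEqDiff, Nat.add_one_sub_one]
            grind
        · intro x m₁ m₂ m' y hx h1 h2
          obtain ⟨a, b, rfl⟩ := List.length_eq_two.1 hx
          simp only [lrel_comp_step, lrel_step, lrel_nil] at h1 h2
          simp only [gen_calc t, list_calc, existsAndEq, prop_calc, Nat.reduceAdd, Nat.reduceEqDiff, Nat.add_one_sub_one] at h1 h2
          first
            | obtain ⟨z, rfl⟩ := h1
              obtain ⟨z', rfl⟩ := h2
              simp only [gen_calc t, list_calc, existsAndEq, prop_calc, Nat.reduceAdd, Nat.reduceEqDiff, Nat.add_one_sub_one]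
              grind
            | obtain ⟨z, hz, w, rfl⟩ := h1
              obtain ⟨z', hz', w', rfl⟩ := h2
              simp only [gen_calc t, list_calc, existsAndEq, prop_calc, Nat.reduceAdd, Nat.reduceEqDiff, Nat.add_one_sub_one]
              grind
      · intro x y hx
        obtain ⟨a, b, rfl⟩ := List.length_eq_two.1 hx
        simp only [lrel_comp_step, lrel_step, lrel_nil]
        simp only [gen_calc t, list_calc, existsAndEq, prop_calc, Nat.reduceAdd, Nat.reduceEqDiff, Nat.add_one_sub_one]
        grind
  | rotate x hd hc =>
    cases x <;> try simp [Elem.dom] at hd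
    all_goals
      generalize_proofs
      refine ⟨?_, ?_, ?_⟩
      · apply ldet_cap
        · apply ldet_cap
          · repeat' first | apply ldet_comp_step | apply ldet_step
            all_goals simp
          · intro x m₁ m₂ m' y hx h1 h2
            obtain ⟨a, b, rfl⟩ := List.length_eq_two.1 hx
            simp only [lrel_comp_step, lrel_step, lrel_nil] at h1 h2
            simp only [gen_calc t, list_calc, existsAndEq, prop_calc, Nat.reduceAdd, Nat.reduceEqDiff, Nat.add_one_sub_one] at h1 h2
            obtain ⟨z, w, rfl⟩ := h1
            obtain ⟨z', w', rfl⟩ := h2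
            simp only [gen_calc t, list_calc, existsAndEq, prop_calc, Nat.reduceAdd, Nat.reduceEqDiff, Nat.add_one_sub_one]
            grind
        · intro x m₁ m₂ m' y hx h1 h2
          obtain ⟨a, b, rfl⟩ := List.length_eq_two.1 hx
          simp only [lrel_comp_step, lrel_step, lrel_nil] at h1 h2
          simp only [gen_calc t, list_calc, existsAndEq, prop_calc, Nat.reduceAdd, Nat.reduceEqDiff, Nat.add_one_sub_one] at h1 h2
          first
            | obtain ⟨z, rfl⟩ := h1
              obtain ⟨z', rfl⟩ := h2
              simp only [gen_calc t, list_calc, existsAndEq, prop_calc, Nat.reduceAdd, Nat.reduceEqDiff, Nat.add_one_sub_one]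
              grind
            | obtain ⟨z, w, hz, rfl⟩ := h1
              obtain ⟨z', w', hz', rfl⟩ := h2
              simp only [gen_calc t, list_calc, existsAndEq, prop_calc, Nat.reduceAdd, Nat.reduceEqDiff, Nat.add_one_sub_one]
              grind
      · apply ldet_cap
        · apply ldet_cap
          · repeat' first | apply ldet_comp_step | apply ldet_step
            all_goals simp
          · intro x m₁ m₂ m' y hx h1 h2
            obtain ⟨a, b, rfl⟩ := List.length_eq_two.1 hx
            simp only [lrel_comp_step, lrel_step, lrel_nil] at h1 h2
            simp only [gen_calc t, list_calc, existsAndEq, prop_calc, Nat.reduceAdd, Nat.reduceEqDiff, Nat.add_one_sub_one] at h1 h2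
            obtain ⟨z, w, rfl⟩ := h1
            obtain ⟨z', w', rfl⟩ := h2
            simp only [gen_calc t, list_calc, existsAndEq, prop_calc, Nat.reduceAdd, Nat.reduceEqDiff, Nat.add_one_sub_one]
            grind
        · intro x m₁ m₂ m' y hx h1 h2
          obtain ⟨a, b, rfl⟩ := List.length_eq_two.1 hx
          simp only [lrel_comp_step, lrel_step, lrel_nil] at h1 h2
          simp only [gen_calc t, list_calc, existsAndEq, prop_calc, Nat.reduceAdd, Nat.reduceEqDiff, Nat.add_one_sub_one] at h1 h2
          first
            | obtain ⟨z, rfl⟩ := h1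
              obtain ⟨z', rfl⟩ := h2
              simp only [gen_calc t, list_calc, existsAndEq, prop_calc, Nat.reduceAdd, Nat.reduceEqDiff, Nat.add_one_sub_one]
              grind
            | obtain ⟨z, w, hz, rfl⟩ := h1
              obtain ⟨z', w', hz', rfl⟩ := h2
              simp only [gen_calc t, list_calc, existsAndEq, prop_calc, Nat.reduceAdd, Nat.reduceEqDiff, Nat.add_one_sub_one]
              grind
      · intro x y hx
        obtain ⟨a, b, rfl⟩ := List.length_eq_two.1 hx
        simp only [lrel_comp_step, lrel_step, lrel_nil]
        simp only [gen_calc t, list_calc, existsAndEq, prop_calc, Nat.reduceAdd, Nat.reduceEqDiff, Nat.add_one_sub_one]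
        constructor <;> grind

theorem exchange_left (t : ℂˣ) (a : List PtSign) (g : Elem) (m : List PtSign) (h : Elem)
    (b : List PtSign) {X Y Z : List PtSign} (e₁ : X = a ++ g.dom ++ (m ++ h.dom ++ b))
    (e₂ : Y = a ++ g.cod ++ (m ++ h.dom ++ b)) (e₃ : Y = (a ++ g.cod ++ m) ++ h.dom ++ b)
    (e₄ : Z = (a ++ g.cod ++ m) ++ h.cod ++ b) :
    LDet t ((step X Y a g (m ++ h.dom ++ b) e₁ e₂).comp (step Y Z (a ++ g.cod ++ m) h b e₃ e₄)) ∧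
    ∀ x y, LRel t ((step X Y a g (m ++ h.dom ++ b) e₁ e₂).comp
        (step Y Z (a ++ g.cod ++ m) h b e₃ e₄)) x y ↔
      ∃ u p p' w q q' v, u.length = a.length ∧ w.length = m.length ∧ v.length = b.length ∧
        GenRel t g p p' ∧ GenRel t h q q' ∧ x = u ++ p ++ w ++ q ++ v ∧
        y = u ++ p' ++ w ++ q' ++ v := by
  refine ⟨⟨ldet_step t _ _ _ _ _, ?_⟩, fun x y => ⟨?_, ?_⟩⟩
  · rintro x m₁ m₂ y ⟨x₁, ⟨-, rfl⟩, u, p, p', v, hu, hv, hg, rfl, rfl⟩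
      ⟨x₂, ⟨-, rfl⟩, u₁, p₁, p₁', v₁, hu₁, hv₁, hg₁, e, rfl⟩
      ⟨r, q, q', s, hr, hs, hh, e', rfl⟩ ⟨r₁, q₁, q₁', s₁, hr₁, hs₁, hh₁, e₁', e''⟩
    simp only at hu hv hu₁ hv₁ hr hs hr₁ hs₁ hg hg₁ hh hh₁
    obtain ⟨e2, rfl⟩ := List.append_inj' e (by omega)
    obtain ⟨rfl, rfl⟩ := List.append_inj e2 (by omega)
    have l1 := hg.length
    have l2 := hg₁.length
    obtain ⟨e3, -⟩ := List.append_inj' e'' (by omega)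
    obtain ⟨rfl, -⟩ := List.append_inj e3 (by omega)
    simp only [List.length_append] at hr hv
    obtain ⟨w, q₂, v₂, hw, hq₂, hv₂, rfl⟩ :=
      exists_split v m.length h.dom.length b.length (by omega)
    have l3 := hh.length
    have l4 := hh₁.length
    have d : (u ++ p' ++ w) ++ q₂ ++ v₂ = r ++ q ++ s := by simpa using e'
    have d₁ : (u ++ p₁' ++ w) ++ q₂ ++ v₂ = r ++ q₁ ++ s₁ := by simpa using e₁'
    obtain ⟨d2, -⟩ := List.append_inj' d (by omega)
    obtain ⟨d2₁, -⟩ := List.append_inj' d₁ (by omega)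
    obtain ⟨d3, -⟩ := List.append_inj' d2 (by omega)
    obtain ⟨d3₁, -⟩ := List.append_inj' d2₁ (by omega)
    rw [List.append_cancel_left (List.append_cancel_right (d3.trans d3₁.symm))]
  · rintro ⟨m₁, ⟨x₁, ⟨-, rfl⟩, u, p, p', v, hu, hv, hg, rfl, rfl⟩, r, q, q', s, hr, hs, hh, e', rfl⟩
    simp only at hu hv hr hs hg hh
    have l1 := hg.length
    have l2 := hh.length
    simp only [List.length_append] at hr hv
    obtain ⟨w, q₁, v₂, hw, hq, hv₂, rfl⟩ := exists_split v m.length h.dom.length b.length (by omega)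
    have e2 : (u ++ p' ++ w) ++ q₁ ++ v₂ = r ++ q ++ s := by simpa using e'
    obtain ⟨e3, rfl⟩ := List.append_inj' e2 (by omega)
    obtain ⟨rfl, rfl⟩ := List.append_inj' e3 (by omega)
    exact ⟨u, p, p', w, q₁, q', v₂, hu, hw, hv₂, hg, hh, by simp, by simp⟩
  · rintro ⟨u, p, p', w, q, q', v, hu, hw, hv, hg, hh, rfl, rfl⟩
    have l1 := hg.length
    have l2 := hh.length
    refine ⟨_, ⟨_, ⟨?_, rfl⟩, u, p, p', w ++ q ++ v, hu, ?_, hg, by simp, rfl⟩,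
      u ++ p' ++ w, q, q', v, ?_, hv, hh, by simp, rfl⟩
    · simp [e₁, hu, l1, hw, l2, hv]
    · simp [l2, hw, hv]
    · simp [l1, hw, hu]

theorem exchange_right (t : ℂˣ) (a : List PtSign) (g : Elem) (m : List PtSign) (h : Elem)
    (b : List PtSign) {X Y Z : List PtSign} (e₁ : X = (a ++ g.dom ++ m) ++ h.dom ++ b)
    (e₂ : Y = (a ++ g.dom ++ m) ++ h.cod ++ b) (e₃ : Y = a ++ g.dom ++ (m ++ h.cod ++ b))
    (e₄ : Z = a ++ g.cod ++ (m ++ h.cod ++ b)) :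
    LDet t ((step X Y (a ++ g.dom ++ m) h b e₁ e₂).comp (step Y Z a g (m ++ h.cod ++ b) e₃ e₄)) ∧
    ∀ x y, LRel t ((step X Y (a ++ g.dom ++ m) h b e₁ e₂).comp
        (step Y Z a g (m ++ h.cod ++ b) e₃ e₄)) x y ↔
      ∃ u p p' w q q' v, u.length = a.length ∧ w.length = m.length ∧ v.length = b.length ∧
        GenRel t g p p' ∧ GenRel t h q q' ∧ x = u ++ p ++ w ++ q ++ v ∧
        y = u ++ p' ++ w ++ q' ++ v := by
  refine ⟨⟨ldet_step t _ _ _ _ _, ?_⟩, fun x y => ⟨?_, ?_⟩⟩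
  · rintro x m₁ m₂ y ⟨x₁, ⟨-, rfl⟩, r, q, q', s, hr, hs, hh, rfl, rfl⟩
      ⟨x₂, ⟨-, rfl⟩, r₁, q₁, q₁', s₁, hr₁, hs₁, hh₁, e, rfl⟩
      ⟨u, p, p', v, hu, hv, hg, e', rfl⟩ ⟨u₁, p₁, p₁', v₁, hu₁, hv₁, hg₁, e₁', e''⟩
    simp only at hu hv hu₁ hv₁ hr hs hr₁ hs₁ hg hg₁ hh hh₁
    obtain ⟨e2, rfl⟩ := List.append_inj' e (by omega)
    obtain ⟨rfl, rfl⟩ := List.append_inj e2 (by omega)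
    have l1 := hg.length
    have l2 := hg₁.length
    have l3 := hh.length
    have l4 := hh₁.length
    obtain ⟨-, rfl⟩ := List.append_inj' e'' (by omega)
    simp only [List.length_append] at hr hv
    obtain ⟨u₂, p₂, w, hu₂, hp₂, hw, rfl⟩ :=
      exists_split r a.length g.dom.length m.length (by omega)
    have d : u₂ ++ p₂ ++ (w ++ q' ++ s) = u ++ p ++ v := by simpa using e'
    have d₁ : u₂ ++ p₂ ++ (w ++ q₁' ++ s) = u₁ ++ p₁ ++ v := by simpa using e₁'
    have ls : (w ++ q' ++ s).length = v.length := by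
      simp only [List.length_append]
      omega
    have ls₁ : (w ++ q₁' ++ s).length = v.length := by
      simp only [List.length_append]
      omega
    obtain ⟨-, d2⟩ := List.append_inj' d ls
    obtain ⟨-, d2₁⟩ := List.append_inj' d₁ ls₁
    rw [List.append_cancel_left (List.append_cancel_right (d2.trans d2₁.symm))]
  · rintro ⟨m₁, ⟨x₁, ⟨-, rfl⟩, r, q, q', s, hr, hs, hh, rfl, rfl⟩, u, p, p', v, hu, hv, hg, e', rfl⟩
    simp only at hu hv hr hs hg hh
    have l1 := hg.length
    have l2 := hh.length
    simp only [List.length_append] at hr hv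
    obtain ⟨u₂, p₂, w, hu₂, hp₂, hw, rfl⟩ :=
      exists_split r a.length g.dom.length m.length (by omega)
    have d : u₂ ++ p₂ ++ (w ++ q' ++ s) = u ++ p ++ v := by simpa using e'
    have ls : (w ++ q' ++ s).length = v.length := by
      simp only [List.length_append]
      omega
    obtain ⟨d2, rfl⟩ := List.append_inj' d ls
    obtain ⟨rfl, rfl⟩ := List.append_inj' d2 (by omega)
    exact ⟨u₂, p₂, p', w, q, q', s, hu, hw, hs, hg, hh, by simp, by simp⟩
  · rintro ⟨u, p, p', w, q, q', v, hu, hw, hv, hg, hh, rfl, rfl⟩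
    have l1 := hg.length
    have l2 := hh.length
    refine ⟨_, ⟨_, ⟨?_, rfl⟩, u ++ p ++ w, q, q', v, ?_, hv, hh, by simp, rfl⟩,
      u, p, p', w ++ q' ++ v, hu, ?_, hg, by simp, by simp⟩
    · simp [e₁, hu, l1, hw, l2, hv]
    · simp [l1, hw, hu]
    · simp [l2, hw, hv]

theorem alexSpan_isotopy (t : ℂˣ) ⦃X Y : Paths (List PtSign)⦄ (D D' : X ⟶ Y)
    (h : Isotopy D D') : (alexDiagram t).map D = (alexDiagram t).map D' := by
  cases h with
  | move a b h =>
    obtain ⟨h1, h2, h3⟩ := move_aux t h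
    refine SpanVect.ofSpan_eq (alexSpan_equiv t _ _ (ldet_whisker t a b _ h1)
      (ldet_whisker t a b _ h2) fun x y => ?_)
    refine (lrel_whisker t a b _ x y).trans (Iff.trans ?_ (lrel_whisker t a b _ x y).symm)
    constructor
    · rintro ⟨u, x', y', v, hu, hv, h, hx, hy⟩
      exact ⟨u, x', y', v, hu, hv, (h3 _ _ h.length.1).1 h, hx, hy⟩
    · rintro ⟨u, x', y', v, hu, hv, h, hx, hy⟩
      exact ⟨u, x', y', v, hu, hv, (h3 _ _ h.length.1).2 h, hx, hy⟩
  | exchange a g m h b =>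
    obtain ⟨h1, h2⟩ := exchange_left t a g m h b
      (X := a ++ g.dom ++ m ++ h.dom ++ b) (Y := a ++ g.cod ++ m ++ h.dom ++ b)
      (Z := a ++ g.cod ++ m ++ h.cod ++ b) (by simp) (by simp) rfl rfl
    obtain ⟨h3, h4⟩ := exchange_right t a g m h b
      (X := a ++ g.dom ++ m ++ h.dom ++ b) (Y := a ++ g.dom ++ m ++ h.cod ++ b)
      (Z := a ++ g.cod ++ m ++ h.cod ++ b) rfl rfl (by simp) (by simp)
    exact SpanVect.ofSpan_eq (alexSpan_equiv t _ _ h1 h3 fun x y => (h2 x y).trans (h4 x y).symm)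

/-- The functor `𝒜_t` from oriented tangles to spans of finite-dimensional vector spaces. -/
def alexTQFT (t : ℂˣ) : Tangle ⥤ SpanVect :=
  CategoryTheory.Quotient.lift isotopyRel (alexDiagram t)
    fun _ _ D D' h => alexSpan_isotopy t D D' h

/-! ### Braids -/

/-- The slices of the diagram are all crossings, so that its strands move upwards. -/
def Diagram.IsBraid {X : List PtSign} : {Y : List PtSign} → Diagram X Y → Prop
  | _, .nil => True
  | _, .cons D s => Diagram.IsBraid D ∧ (s.gen = .crossPos ∨ s.gen = .crossNeg)

/-- The object `(+, …, +)` of the category of tangles. -/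
def plus (n : ℕ) : Tangle := ⟨List.replicate n pos⟩

/-- A tangle between sequences of positive points is a braid if it has a diagram whose strands move
upwards. -/
def IsBraid {m n : ℕ} (T : plus m ⟶ plus n) : Prop :=
  ∃ D : Diagram (List.replicate m pos) (List.replicate n pos),
    D.IsBraid ∧ T = Tangle.ofDiagram D

/-- The relations of the Artin presentation of the braid group on `n` strands. -/
def artinRels (n : ℕ) : Set (FreeGroup (Fin (n - 1))) :=
  {r | ∃ i j : Fin (n - 1),
    (i.val + 2 ≤ j.val ∧ r = .of i * .of j * (.of j * .of i)⁻¹) ∨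
    (i.val + 1 = j.val ∧ r = .of i * .of j * .of i * (.of j * .of i * .of j)⁻¹)}

/-- The Artin braid group on `n` strands. -/
abbrev BraidGroup (n : ℕ) : Type := PresentedGroup (artinRels n)

namespace BraidGroup

/-- The generator that crosses the strands `k` and `k + 1`, counted from `0` (the unit element if
there are no such strands). -/
def σ (n k : ℕ) : BraidGroup n :=
  if h : k < n - 1 then PresentedGroup.of ⟨k, h⟩ else 1

theorem σ_comm (n : ℕ) {i j : ℕ} (h : i + 2 ≤ j) : σ n i * σ n j = σ n j * σ n i := by
  by_cases hj : j < n - 1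
  · have hi : i < n - 1 := by omega
    have e : (.of ⟨i, hi⟩ * .of ⟨j, hj⟩ * (.of ⟨j, hj⟩ * .of ⟨i, hi⟩)⁻¹ : BraidGroup n) = 1 :=
      PresentedGroup.one_of_mem (rels := artinRels n) ⟨⟨i, hi⟩, ⟨j, hj⟩, Or.inl ⟨h, rfl⟩⟩
    simp only [σ, hi, hj, dif_pos]
    exact mul_inv_eq_one.1 e
  · simp [σ, hj]

theorem σ_braid (n : ℕ) {i : ℕ} (h : i + 1 < n - 1) :
    σ n i * σ n (i + 1) * σ n i = σ n (i + 1) * σ n i * σ n (i + 1) := by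
  have hi : i < n - 1 := by omega
  have e : (.of ⟨i, hi⟩ * .of ⟨i + 1, h⟩ * .of ⟨i, hi⟩ *
      (.of ⟨i + 1, h⟩ * .of ⟨i, hi⟩ * .of ⟨i + 1, h⟩)⁻¹ : BraidGroup n) = 1 :=
    PresentedGroup.one_of_mem (rels := artinRels n) ⟨⟨i, hi⟩, ⟨i + 1, h⟩, Or.inr ⟨rfl, rfl⟩⟩
  simp only [σ, hi, h, dif_pos]
  exact mul_inv_eq_one.1 e

/-- The homomorphism from the braid group given by elements that satisfy the Artin relations. -/
def lift {n : ℕ} {G : Type} [Group G] (f : Fin (n - 1) → G)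
    (hc : ∀ i j, i.val + 2 ≤ j.val → f i * f j = f j * f i)
    (hb : ∀ i j, i.val + 1 = j.val → f i * f j * f i = f j * f i * f j) : BraidGroup n →* G :=
  PresentedGroup.toGroup (f := f) <| by
    rintro r ⟨i, j, ⟨h, rfl⟩ | ⟨h, rfl⟩⟩
    · simpa [mul_inv_eq_one, -mul_inv_rev] using hc i j h
    · simpa [mul_inv_eq_one, -mul_inv_rev] using hb i j h

/-- Adding `n` vertical strands to the right of a braid. -/
def inclLeft (m n : ℕ) : BraidGroup m →* BraidGroup (m + n) :=
  lift (fun i => σ (m + n) i) (fun _ _ h => σ_comm _ h) fun i j h => by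
    have := j.isLt
    rw [← h]
    exact σ_braid _ (by omega)

/-- Adding `m` vertical strands to the left of a braid. -/
def inclRight (m n : ℕ) : BraidGroup n →* BraidGroup (m + n) :=
  lift (fun i => σ (m + n) (m + i)) (fun _ _ h => σ_comm _ (by omega)) fun i j h => by
    have := j.isLt
    rw [← h]
    exact σ_braid _ (by omega)

/-- The braid that carries the first `m` strands, as a parallel bundle, over the last `n` strands.
In a product of braids, the rightmost factor is at the bottom. -/
def shuffle (m n : ℕ) : BraidGroup (m + n) :=
  ((List.range m).map fun i =>
    ((List.range n).reverse.map fun j => σ (m + n) (i + j)).prod).prod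

end BraidGroup

/-- The morphisms of the category of braids: from `n` to `n` the elements of the braid group, and
none between different numbers of strands. -/
inductive BraidHom : ℕ → ℕ → Type
  | mk {n : ℕ} (b : BraidGroup n) : BraidHom n n

namespace BraidHom

def comp : {k m n : ℕ} → BraidHom k m → BraidHom m n → BraidHom k n
  | _, _, _, mk b, mk c => mk (c * b)

/-- Juxtaposition of braids. -/
def tensor : {m n m' n' : ℕ} → BraidHom m n → BraidHom m' n' → BraidHom (m + m') (n + n')
  | m, _, m', _, mk b, mk b' =>
    mk (BraidGroup.inclLeft m m' b * BraidGroup.inclRight m m' b')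

end BraidHom

/-- The category of braids. An object is a number of strands, and the composite of `b` and `c` is
the braid with `b` at the bottom and `c` on top, written `c * b` in the braid group. -/
structure BraidCat : Type where
  strands : ℕ

namespace BraidCat

instance : Category.{0} BraidCat where
  Hom m n := BraidHom m.strands n.strands
  id n := BraidHom.mk 1
  comp := BraidHom.comp
  id_comp := by
    rintro ⟨_⟩ ⟨_⟩ ⟨b⟩
    exact congrArg BraidHom.mk (mul_one b)
  comp_id := by
    rintro ⟨_⟩ ⟨_⟩ ⟨b⟩
    exact congrArg BraidHom.mk (one_mul b)
  assoc := by
    rintro ⟨_⟩ ⟨_⟩ ⟨_⟩ ⟨_⟩ ⟨b⟩ ⟨c⟩ ⟨d⟩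
    exact congrArg BraidHom.mk (mul_assoc d c b).symm

/-- An element of the braid group, as an endomorphism in the category of braids. -/
def ofGroup {n : ℕ} (b : BraidGroup n) : (⟨n⟩ : BraidCat) ⟶ ⟨n⟩ := BraidHom.mk b

/-- The tensor product of morphisms: the second braid is placed to the right of the first. -/
def tensor {m n m' n' : ℕ} (b : (⟨m⟩ : BraidCat) ⟶ ⟨n⟩) (b' : (⟨m'⟩ : BraidCat) ⟶ ⟨n'⟩) :
    (⟨m + m'⟩ : BraidCat) ⟶ ⟨n + n'⟩ := BraidHom.tensor b b'

/-- The braiding of the category of braids. -/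
def braiding (m n : ℕ) : (⟨m + n⟩ : BraidCat) ⟶ ⟨n + m⟩ :=
  ofGroup (BraidGroup.shuffle m n) ≫ eqToHom (congrArg BraidCat.mk (Nat.add_comm m n))

end BraidCat

/-! ### Braids as tangles -/

theorem ofDiagram_comp {X Y Z : List PtSign} (D : Diagram X Y) (D' : Diagram Y Z) :
    Tangle.ofDiagram (D.comp D') = Tangle.ofDiagram D ≫ Tangle.ofDiagram D' :=
  (CategoryTheory.Quotient.functor isotopyRel).map_comp D D'

theorem ofDiagram_nil (X : List PtSign) :
    Tangle.ofDiagram (Quiver.Path.nil : Diagram X X) = 𝟙 (⟨X⟩ : Tangle) := rfl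

theorem ofDiagram_eq {X Y : List PtSign} {D D' : Diagram X Y}
    (h : Isotopy (X := X) (Y := Y) D D') : Tangle.ofDiagram D = Tangle.ofDiagram D' :=
  CategoryTheory.Quotient.sound isotopyRel h

theorem whisker_comp (a b : List PtSign) {X Y Z : List PtSign} (D : Diagram X Y)
    (D' : Diagram Y Z) :
    ((whisker a b).mapPath (D.comp D') : Diagram (a ++ X ++ b) (a ++ Z ++ b)) =
      Quiver.Path.comp ((whisker a b).mapPath D : Diagram (a ++ X ++ b) (a ++ Y ++ b))
        ((whisker a b).mapPath D' : Diagram (a ++ Y ++ b) (a ++ Z ++ b)) :=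
  Prefunctor.mapPath_comp _ _ _

theorem step_congr {X Y l l' : List PtSign} {g : Elem} {r r' : List PtSign}
    (h : X = l ++ g.dom ++ r) (h' : Y = l ++ g.cod ++ r) (hl : l = l') (hr : r = r') :
    step X Y l g r h h' = step X Y l' g r' (by rw [h, hl, hr]) (by rw [h', hl, hr]) := by
  subst hl hr
  rfl

theorem tangle_r2 {X l r : List PtSign} {x y : Elem}
    (hx : X = l ++ x.dom ++ r) (hx' : X = l ++ x.cod ++ r)
    (hy : X = l ++ y.dom ++ r) (hy' : X = l ++ y.cod ++ r)
    (h : X = l ++ [pos, pos] ++ r)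
    (e : (x = .crossPos ∧ y = .crossNeg) ∨ (x = .crossNeg ∧ y = .crossPos)) :
    Tangle.ofDiagram (step X X l x r hx hx') ≫ Tangle.ofDiagram (step X X l y r hy hy') = 𝟙 _ := by
  subst h
  rw [← ofDiagram_comp, ← ofDiagram_nil]
  obtain ⟨rfl, rfl⟩ | ⟨rfl, rfl⟩ := e
  · refine Eq.trans ?_ (ofDiagram_eq (.move l r Move.reidemeister₂_posNeg))
    rw [whisker_comp]
    exact congrArg₂ (fun D D' => Tangle.ofDiagram (Quiver.Path.comp D D'))
      (step_congr _ _ (by simp) (by simp)) (step_congr _ _ (by simp) (by simp))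
  · refine Eq.trans ?_ (ofDiagram_eq (.move l r Move.reidemeister₂_negPos))
    rw [whisker_comp]
    exact congrArg₂ (fun D D' => Tangle.ofDiagram (Quiver.Path.comp D D'))
      (step_congr _ _ (by simp) (by simp)) (step_congr _ _ (by simp) (by simp))

theorem tangle_r3 {X l r l₁ r₁ l₂ r₂ : List PtSign} (h : X = l ++ [pos, pos, pos] ++ r)
    (h₁ : X = l₁ ++ Elem.crossPos.dom ++ r₁) (h₁' : X = l₁ ++ Elem.crossPos.cod ++ r₁)
    (h₂ : X = l₂ ++ Elem.crossPos.dom ++ r₂) (h₂' : X = l₂ ++ Elem.crossPos.cod ++ r₂)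
    (e₁ : l₁ = l) (e₁' : r₁ = pos :: r) (e₂ : l₂ = l ++ [pos]) (e₂' : r₂ = r) :
    (Tangle.ofDiagram (step X X l₁ .crossPos r₁ h₁ h₁') ≫
      Tangle.ofDiagram (step X X l₂ .crossPos r₂ h₂ h₂')) ≫
      Tangle.ofDiagram (step X X l₁ .crossPos r₁ h₁ h₁') =
    (Tangle.ofDiagram (step X X l₂ .crossPos r₂ h₂ h₂') ≫
      Tangle.ofDiagram (step X X l₁ .crossPos r₁ h₁ h₁')) ≫
      Tangle.ofDiagram (step X X l₂ .crossPos r₂ h₂ h₂') := by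
  subst h
  have comp₃ : ∀ {A B C E : List PtSign} (D₁ : Diagram A B) (D₂ : Diagram B C) (D₃ : Diagram C E),
      Tangle.ofDiagram ((D₁.comp D₂).comp D₃) =
        (Tangle.ofDiagram D₁ ≫ Tangle.ofDiagram D₂) ≫ Tangle.ofDiagram D₃ := by
    intros
    rw [ofDiagram_comp, ofDiagram_comp]
  have k₁ : step (l ++ [pos, pos, pos] ++ r) (l ++ [pos, pos, pos] ++ r) l₁ .crossPos r₁ h₁ h₁' =
      step _ _ (l ++ []) .crossPos ([pos] ++ r) (by simp [Elem.dom]) (by simp [Elem.cod]) :=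
    step_congr _ _ (by simp [e₁]) (by simp [e₁'])
  have k₂ : step (l ++ [pos, pos, pos] ++ r) (l ++ [pos, pos, pos] ++ r) l₂ .crossPos r₂ h₂ h₂' =
      step _ _ (l ++ [pos]) .crossPos ([] ++ r) (by simp [Elem.dom]) (by simp [Elem.cod]) :=
    step_congr _ _ (by simp [e₂]) (by simp [e₂'])
  rw [k₁, k₂]
  refine (comp₃ _ _ _).symm.trans (Eq.trans ?_ (comp₃ _ _ _))
  exact ofDiagram_eq (.move l r Move.reidemeister₃)

theorem tangle_exchange {X a m b l₁ r₁ l₂ r₂ : List PtSign}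
    (h : X = a ++ [pos, pos] ++ m ++ [pos, pos] ++ b)
    (h₁ : X = l₁ ++ Elem.crossPos.dom ++ r₁) (h₁' : X = l₁ ++ Elem.crossPos.cod ++ r₁)
    (h₂ : X = l₂ ++ Elem.crossPos.dom ++ r₂) (h₂' : X = l₂ ++ Elem.crossPos.cod ++ r₂)
    (e₁ : l₁ = a) (e₁' : r₁ = m ++ [pos, pos] ++ b) (e₂ : l₂ = a ++ [pos, pos] ++ m)
    (e₂' : r₂ = b) :
    Tangle.ofDiagram (step X X l₁ .crossPos r₁ h₁ h₁') ≫
      Tangle.ofDiagram (step X X l₂ .crossPos r₂ h₂ h₂') =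
    Tangle.ofDiagram (step X X l₂ .crossPos r₂ h₂ h₂') ≫
      Tangle.ofDiagram (step X X l₁ .crossPos r₁ h₁ h₁') := by
  subst h e₁ e₁' e₂ e₂'
  exact (ofDiagram_comp _ _).symm.trans
    ((ofDiagram_eq (.exchange l₁ .crossPos m .crossPos r₂)).trans (ofDiagram_comp _ _))

theorem replicate_split {n k : ℕ} (h : k < n - 1) : List.replicate n pos =
    List.replicate k pos ++ [pos, pos] ++ List.replicate (n - 2 - k) pos := by
  have : [pos, pos] = List.replicate 2 pos := rfl
  rw [this, List.replicate_append_replicate, List.replicate_append_replicate]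
  congr 1
  omega

/-- The crossing of the strands `k` and `k + 1` among `n` upward strands. -/
def crossing (n : ℕ) (k : Fin (n - 1)) : Aut (plus n) where
  hom := Tangle.ofDiagram (step _ _ (List.replicate k pos) .crossPos
    (List.replicate (n - 2 - k) pos) (replicate_split k.isLt) (replicate_split k.isLt))
  inv := Tangle.ofDiagram (step _ _ (List.replicate k pos) .crossNeg
    (List.replicate (n - 2 - k) pos) (replicate_split k.isLt) (replicate_split k.isLt))
  hom_inv_id := tangle_r2 _ _ _ _ (replicate_split k.isLt) (Or.inl ⟨rfl, rfl⟩)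
  inv_hom_id := tangle_r2 _ _ _ _ (replicate_split k.isLt) (Or.inr ⟨rfl, rfl⟩)

/-- The tangle of an element of the braid group: the generators are sent to the crossings
`id ⊗ ⋯ ⊗ X₊ ⊗ ⋯ ⊗ id`. -/
def braidAut (n : ℕ) : BraidGroup n →* Aut (plus n) :=
  BraidGroup.lift (crossing n)
    (fun i j h => by
      have hj := j.isLt
      refine Iso.ext (tangle_exchange (a := List.replicate i pos)
        (m := List.replicate (j - i - 2) pos) (b := List.replicate (n - 2 - j) pos)
        ?_ _ _ _ _ rfl ?_ ?_ rfl).symm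
      all_goals
        have e : [pos, pos] = List.replicate 2 pos := rfl
        simp only [e, List.replicate_append_replicate]
        congr 1
        omega)
    (fun i j h => by
      have hj := j.isLt
      refine Iso.ext ((Category.assoc _ _ _).symm.trans ((tangle_r3 (l := List.replicate i pos)
        (r := List.replicate (n - 3 - i) pos) ?_ _ _ _ _ rfl ?_ ?_ ?_).trans
        (Category.assoc _ _ _)))
      all_goals
        have e : [pos, pos, pos] = List.replicate 3 pos := rfl
        have e' : [pos] = List.replicate 1 pos := rfl
        try simp only [e, e', List.replicate_append_replicate, ← List.replicate_succ]
        congr 1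
        omega)

/-- The tangle of a morphism in the category of braids. -/
def BraidHom.toTangle : {m n : ℕ} → BraidHom m n → (plus m ⟶ plus n)
  | _, _, .mk (n := n) b => (braidAut n b).hom

/-- The inclusion of the category of braids into the category of tangles. -/
def braidIncl : BraidCat ⥤ Tangle where
  obj n := plus n.strands
  map b := BraidHom.toTangle b
  map_id n := congrArg Iso.hom (map_one (braidAut n.strands))
  map_comp := by
    rintro ⟨_⟩ ⟨_⟩ ⟨_⟩ ⟨b⟩ ⟨c⟩
    exact congrArg Iso.hom (map_mul (braidAut _) c b)

/-! ### The linear maps of braids -/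

/-- The coordinates on the vector space `Hom(Q, AQ_t)` of the `n`-punctured plane. -/
def coord (t : ℂˣ) (n : ℕ) : boundaryRep t (List.replicate n pos) ≃ₗ[ℂ] (Fin n → ℂ) :=
  (evalEquiv t (Fin (List.replicate n pos).length)).trans
    (LinearEquiv.funCongrLeft ℂ ℂ (finCongr List.length_replicate.symm))

/-- Each braid is sent to a basic span. -/
def BraidsBasic (t : ℂˣ) : Prop :=
  ∀ {m n : BraidCat} (b : m ⟶ n), IsBasic ((braidIncl ⋙ alexTQFT t).map b)

/-- The restriction of `𝒜_t` to braids, as a functor to vector spaces. -/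
def braidTQFT (t : ℂˣ) (h : BraidsBasic t) : BraidCat ⥤ FGModuleCat.{0} ℂ :=
  factorBasic (braidIncl ⋙ alexTQFT t) h

/-- The linear map of a braid, in coordinates. -/
def braidMap (t : ℂˣ) (h : BraidsBasic t) {m n : ℕ} (b : (⟨m⟩ : BraidCat) ⟶ ⟨n⟩) :
    (Fin m → ℂ) →ₗ[ℂ] (Fin n → ℂ) :=
  (coord t n).toLinearMap ∘ₗ ((braidTQFT t h).map b).hom.hom ∘ₗ (coord t m).symm.toLinearMap

theorem braidMap_id (t : ℂˣ) (h : BraidsBasic t) (n : ℕ) :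
    braidMap t h (𝟙 (⟨n⟩ : BraidCat)) = LinearMap.id := by
  apply LinearMap.ext
  intro x
  have e := congrArg (fun f => f.hom.hom ((coord t n).symm x)) ((braidTQFT t h).map_id ⟨n⟩)
  exact (congrArg (coord t n) e).trans ((coord t n).apply_symm_apply x)

theorem braidMap_comp (t : ℂˣ) (h : BraidsBasic t) {k m n : ℕ} (b : (⟨k⟩ : BraidCat) ⟶ ⟨m⟩)
    (c : (⟨m⟩ : BraidCat) ⟶ ⟨n⟩) :
    braidMap t h (b ≫ c) = braidMap t h c ∘ₗ braidMap t h b := by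
  apply LinearMap.ext
  intro x
  have e := congrArg (fun f => f.hom.hom ((coord t k).symm x)) ((braidTQFT t h).map_comp b c)
  refine (congrArg (coord t n) e).trans ?_
  exact congrArg (fun z => coord t n (((braidTQFT t h).map c).hom.hom z))
    ((coord t m).symm_apply_apply _).symm

/-- The representation of the braid group on `n` strands that the functor gives. -/
def braidRep (t : ℂˣ) (h : BraidsBasic t) (n : ℕ) : BraidGroup n →* GL (Fin n) ℂ :=
  MonoidHom.toHomUnits
    { toFun := fun b => LinearMap.toMatrix' (braidMap t h (BraidCat.ofGroup b))
      map_one' := (congrArg LinearMap.toMatrix' (braidMap_id t h n)).trans LinearMap.toMatrix'_id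
      map_mul' := fun b c => (congrArg LinearMap.toMatrix' (braidMap_comp t h
        (BraidCat.ofGroup c) (BraidCat.ofGroup b))).trans (LinearMap.toMatrix'_comp _ _) }

/-- The matrix of the generator `k` in the unreduced Burau representation: the identity matrix,
except for the block `[[1 - t, t], [1, 0]]` in the rows and columns `k` and `k + 1`. -/
def burauMatrix (t : ℂˣ) (n k : ℕ) : Matrix (Fin n) (Fin n) ℂ := fun i j =>
  if i.val = k then
    if j.val = k then 1 - t else if j.val = k + 1 then t else 0
  else if i.val = k + 1 then
    if j.val = k then 1 else 0
  else if i = j then 1 else 0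

/-- A representation of the braid group is the unreduced Burau representation if it sends the
generators to the Burau matrices. -/
def IsBurau (t : ℂˣ) {n : ℕ} (ρ : BraidGroup n →* GL (Fin n) ℂ) : Prop :=
  ∀ k : ℕ, k + 1 < n → (ρ (BraidGroup.σ n k)).val = burauMatrix t n k

/-- The conditions that make the isomorphisms `β m n : ℂᵐ ⊕ ℂⁿ → ℂⁿ ⊕ ℂᵐ` a braiding for the maps
`F b` that belong to braids: naturality and the two hexagon identities. Here the direct sum of two
vectors is `Fin.append`. -/
structure IsBraiding
    (F : ∀ {m n : ℕ}, ((⟨m⟩ : BraidCat) ⟶ ⟨n⟩) → (Fin m → ℂ) →ₗ[ℂ] (Fin n → ℂ))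
    (β : ∀ m n : ℕ, (Fin (m + n) → ℂ) →ₗ[ℂ] (Fin (n + m) → ℂ)) : Prop where
  bijective : ∀ m n : ℕ, Function.Bijective (β m n)
  natural : ∀ {m m' n n' : ℕ} (b : (⟨m⟩ : BraidCat) ⟶ ⟨m'⟩) (c : (⟨n⟩ : BraidCat) ⟶ ⟨n'⟩)
    (x x₁ : Fin m → ℂ) (y y₁ : Fin n → ℂ), β m n (Fin.append x y) = Fin.append y₁ x₁ →
      β m' n' (Fin.append (F b x) (F c y)) = Fin.append (F c y₁) (F b x₁)
  hexagon_right : ∀ {m n k : ℕ} (x x₁ x₂ : Fin m → ℂ) (y y₁ : Fin n → ℂ) (z z₁ : Fin k → ℂ),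
    β m n (Fin.append x y) = Fin.append y₁ x₁ → β m k (Fin.append x₁ z) = Fin.append z₁ x₂ →
      β m (n + k) (Fin.append x (Fin.append y z)) = Fin.append (Fin.append y₁ z₁) x₂
  hexagon_left : ∀ {m n k : ℕ} (x x₁ : Fin m → ℂ) (y y₁ : Fin n → ℂ) (z z₁ z₂ : Fin k → ℂ),
    β n k (Fin.append y z) = Fin.append z₁ y₁ → β m k (Fin.append x z₁) = Fin.append z₂ x₁ →
      β (m + n) k (Fin.append (Fin.append x y) z) = Fin.append z₂ (Fin.append x₁ y₁)

end

end TangleTQFT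

open TangleTQFT

/-! In a braid diagram every slice is a crossing, and a crossing is a function from the two colors
below it to the two colors above it. A coloring of the whole diagram in the Alexander quandle is
therefore the same as an arbitrary coloring of its bottom (`LRel.existsUnique`). In terms of spans,
the left leg is invertible (`alexSpan_left_bijective`), and a span with invertible left leg is the
basic span of the right leg composed with the inverse of the left one (`IsBasic.of_left_bijective`).
An element of the braid group is a product of generators and their inverses, each of them the class
of a diagram with one crossing, and composites of basic spans are basic; so every morphism of the
braid category has a basic span (`braidsBasic`). Since `basicSpan` is faithful and injective on
objects, the functor factors through vector spaces in exactly one way.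

The resulting linear maps are determined by the generators. The map of a braid takes the bottom
colors of any diagram of it to the top colors (`lrel_braidMap`); for one crossing this is the
Wirtinger rule, `braidEnd_σ`, which is the Burau matrix. Additivity under juxtaposition follows by
induction over the braid group.

For the braiding, a strand of color c that passes over strands of colors b keeps its color and
replaces each b by t b + (1 - t) c. Iterating this over a bundle of m strands (`extendZero_strand`,
`extendZero_bundle`) gives, with ℓ(a) = ∑ tⁱ aᵢ (i counted from 0) and 𝟙 = (1, …, 1), the formula
β(a, b) = ((1 - t) ℓ(a) 𝟙 + tᵐ b, a). Naturality then amounts to two invariants of the Burau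
representation: it preserves the form ℓ (`sum_braidEnd`) and fixes the vector 𝟙 (`braidEnd_const`).
One hexagon holds because β treats the entries of b separately, the other because ℓ(a, a') = ℓ(a) +
tᵐ ℓ(a') for a of length m. -/

namespace TangleTQFT

open PtSign

/-! ### Spans with an invertible left leg -/

theorem IsBasic.comp {U V W : SpanVect} {s : U ⟶ V} {s' : V ⟶ W} (h : IsBasic s)
    (h' : IsBasic s') : IsBasic (s ≫ s') := by
  obtain ⟨f, rfl⟩ := h
  obtain ⟨g, rfl⟩ := h'
  exact ⟨f ≫ g, SpanVect.ofSpan_eq (LinSpan.basic_comp f.hom.hom g.hom.hom)⟩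

/-- The left leg itself is the isomorphism of middle spaces: transporting along it turns the left
leg into the identity and the right leg into `right ∘ left⁻¹`. -/
theorem IsBasic.of_left_bijective {V W : SpanVect} (s : LinSpan V.space W.space)
    (h : Function.Bijective s.left) : IsBasic (SpanVect.ofSpan s : V ⟶ W) :=
  ⟨FGModuleCat.ofHom (s.right ∘ₗ (LinearEquiv.ofBijective s.left h).symm.toLinearMap),
    SpanVect.ofSpan_eq ⟨LinearEquiv.ofBijective s.left h, fun _ => rfl, fun z =>
      congrArg s.right ((LinearEquiv.ofBijective s.left h).symm_apply_apply z)⟩⟩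

/-! ### Propagation of colors through braid diagrams -/

theorem GenRel.existsUnique {t : ℂˣ} {g : Elem} (hg : g = .crossPos ∨ g = .crossNeg) {x : List ℂ}
    (hx : x.length = g.dom.length) : ∃! y, GenRel t g x y := by
  obtain rfl | rfl := hg
  all_goals
    obtain ⟨a, b, rfl⟩ := List.length_eq_two.1 hx
    simp [GenRel]

/-- The strands beside the crossing keep their colors, so everything reduces to the two colors in
the middle, which `srel_iff` cuts out of the list. -/
theorem SRel.existsUnique {t : ℂˣ} {X Y : List PtSign} {s : Slice X Y}
    (hs : s.gen = .crossPos ∨ s.gen = .crossNeg) {x : List ℂ} (hx : x.length = X.length) :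
    ∃! y, SRel t s x y := by
  have hX : X.length = s.left.length + s.gen.dom.length + s.right.length := by
    simpa [add_assoc] using congrArg List.length s.dom_eq
  obtain ⟨m, hm, hu⟩ := GenRel.existsUnique (t := t) hs
    (x := (x.drop s.left.length).take s.gen.dom.length) (by simp; omega)
  refine ⟨_, (srel_iff t s _ _).2 ⟨hx, m, hm, rfl⟩, fun y hy => ?_⟩
  obtain ⟨-, m', hm', rfl⟩ := (srel_iff t s _ _).1 hy
  rw [hu m' hm']

/-- Colors propagate upwards, level by level. Both halves need a braid: a cap constrains the colors
below it, so existence would fail, and a cup introduces a free color, so uniqueness would fail. -/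
theorem LRel.existsUnique {t : ℂˣ} {X Y : List PtSign} {D : Diagram X Y} (hD : D.IsBraid)
    {x : List ℂ} (hx : x.length = X.length) : ∃! y, LRel t D x y := by
  induction D with
  | nil => exact ⟨x, ⟨hx, rfl⟩, fun y hy => hy.2.symm⟩
  | cons D s ih =>
    obtain ⟨m, hm, hu⟩ := ih hD.1
    obtain ⟨y, hy, hy'⟩ := SRel.existsUnique (t := t) hD.2 hm.length.2
    refine ⟨y, ⟨m, hm, hy⟩, ?_⟩
    rintro z ⟨m', hm', hz⟩
    obtain rfl := hu m' hm'
    exact hy' z hz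

/-- Every intermediate level is already determined by the bottom, so the top colors play no role
here. -/
theorem ldet_of_isBraid (t : ℂˣ) {X Y : List PtSign} {D : Diagram X Y} (hD : D.IsBraid) :
    LDet t D := by
  induction D with
  | nil => trivial
  | cons D s ih =>
    exact ⟨ih hD.1, fun x m m' y h h' _ _ => (LRel.existsUnique hD.1 h.length.1).unique h h'⟩

/-- A representation of the quandle of `D` is a coloring of its edges, and the left leg reads off
the bottom colors. Uniqueness of propagation makes it injective, existence makes it surjective. -/
theorem alexSpan_left_bijective (t : ℂˣ) {X Y : List PtSign} {D : Diagram X Y} (hD : D.IsBraid) :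
    Function.Bijective (alexSpan t D).left := by
  constructor
  · intro f f' h
    have hb := ((left_eq_iff t D f _).1 h).trans ((left_eq_iff t D f' _).1 rfl).symm
    have hc := (exists_rep_iff t D _).1 ⟨f, rfl⟩
    have hc' := (exists_rep_iff t D _).1 ⟨f', rfl⟩
    have r := lrel_of_isCol t D _ hc
    have r' := lrel_of_isCol t D _ hc'
    -- `isCol_unique` asks for equal colors at the top as well as at the bottom; the top is the
    -- remaining goal, and it follows from the bottom by uniqueness of propagation.
    refine evalGen_injective t _ (isCol_unique t D (ldet_of_isBraid t hD) _ _ hc hc' hb ?_)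
    refine List.ofFn_injective ((LRel.existsUnique hD r.length.1).unique r ?_)
    rw [← hb] at r'
    exact r'
  · intro x
    obtain ⟨y, hy, -⟩ := LRel.existsUnique (t := t) hD
      (x := List.ofFn (evalEquiv t (Fin X.length) x)) List.length_ofFn
    obtain ⟨c, hc, h1, -⟩ := exists_isCol t D _ _ hy
    obtain ⟨f, rfl⟩ := (exists_rep_iff t D c).2 hc
    exact ⟨f, (left_eq_iff t D f x).2 (List.ofFn_injective h1)⟩

theorem isBasic_ofDiagram (t : ℂˣ) {X Y : List PtSign} {D : Diagram X Y} (hD : D.IsBraid) :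
    IsBasic ((alexTQFT t).map (Tangle.ofDiagram D)) :=
  -- The value of `alexTQFT t` on the class of `D` is by definition the class of `alexSpan t D`.
  IsBasic.of_left_bijective (V := ⟨boundaryRep t X⟩) (W := ⟨boundaryRep t Y⟩) (alexSpan t D)
    (alexSpan_left_bijective t hD)

theorem isBasic_of_isBraid (t : ℂˣ) {m n : ℕ} {T : plus m ⟶ plus n} (hT : IsBraid T) :
    IsBasic ((alexTQFT t).map T) := by
  obtain ⟨D, hD, rfl⟩ := hT
  exact isBasic_ofDiagram t hD

/-- If the span of a diagram is basic, its linear map sends the colors of the bottom to the colors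
of the top. -/
theorem lrel_of_basic (t : ℂˣ) {X Y : List PtSign} (D : Diagram X Y)
    (f : boundaryRep t X →ₗ[ℂ] boundaryRep t Y)
    (h : LinSpan.Equiv (alexSpan t D) (LinSpan.basic f)) (x : boundaryRep t X) :
    LRel t D (List.ofFn (evalEquiv t _ x)) (List.ofFn (evalEquiv t _ (f x))) := by
  obtain ⟨φ, h, h'⟩ := h
  -- The middle space of the basic span is the space of bottom colorings, so `φ.symm x` is the
  -- coloring of `D` that extends `x`; its top is then `f x`.
  have hl : (alexSpan t D).left (φ.symm x) = x := (h _).symm.trans (φ.apply_symm_apply x)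
  have hr : (alexSpan t D).right (φ.symm x) = f x :=
    (h' _).symm.trans (congrArg f (φ.apply_symm_apply x))
  rw [← (left_eq_iff t D _ _).1 hl, ← (right_eq_iff t D _ _).1 hr]
  exact lrel_of_isCol t D _ ((exists_rep_iff t D _).1 ⟨φ.symm x, rfl⟩)

/-! ### Every element of the braid group has a basic span -/

/-- An induction principle for braids. -/
theorem BraidGroup.induction {n : ℕ} {P : BraidGroup n → Prop} (one : P 1)
    (mul : ∀ b c, P b → P c → P (b * c)) (inv : ∀ b, P b → P b⁻¹)
    (gen : ∀ k, k + 1 < n → P (BraidGroup.σ n k)) (b : BraidGroup n) : P b := by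
  have hb : b ∈ Subgroup.closure (Set.range (PresentedGroup.of (rels := artinRels n))) := by
    rw [PresentedGroup.closure_range_of]
    trivial
  induction hb using Subgroup.closure_induction with
  | mem x hx =>
    obtain ⟨k, rfl⟩ := hx
    have h := gen k (by have := k.isLt; omega)
    rwa [BraidGroup.σ, dif_pos k.isLt] at h
  | one => exact one
  | mul x y _ _ hx hy => exact mul x y hx hy
  | inv x _ hx => exact inv x hx

theorem BraidGroup.lift_σ {n : ℕ} {G : Type} [Group G] (f : Fin (n - 1) → G)
    (hc : ∀ i j, i.val + 2 ≤ j.val → f i * f j = f j * f i)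
    (hb : ∀ i j, i.val + 1 = j.val → f i * f j * f i = f j * f i * f j) {k : ℕ} (hk : k < n - 1) :
    BraidGroup.lift f hc hb (BraidGroup.σ n k) = f ⟨k, hk⟩ := by
  rw [BraidGroup.σ, dif_pos hk, BraidGroup.lift, PresentedGroup.toGroup.of]

theorem braidAut_σ {n k : ℕ} (h : k + 1 < n) :
    braidAut n (BraidGroup.σ n k) = crossing n ⟨k, by omega⟩ :=
  BraidGroup.lift_σ _ _ _ _

/-- An element of the braid group comes without a chosen diagram, so the argument runs over products
of generators and inverses, using that composites of basic spans are basic. -/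
theorem braidsBasic (t : ℂˣ) : BraidsBasic t := by
  -- The span of the inverse tangle is carried along: passing to `b⁻¹` then only swaps the two
  -- claims, and nothing has to be known about inverses of basic spans.
  have key : ∀ (n : ℕ) (b : BraidGroup n), IsBasic ((alexTQFT t).map (braidAut n b).hom) ∧
      IsBasic ((alexTQFT t).map (braidAut n b).inv) := by
    intro n b
    induction b using BraidGroup.induction with
    | one =>
      have : IsBasic ((alexTQFT t).map (𝟙 (plus n))) :=
        isBasic_ofDiagram t (D := (Quiver.Path.nil : Diagram (List.replicate n pos) _)) trivial
      rw [map_one]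
      exact ⟨this, this⟩
    | mul b c hb hc =>
      rw [map_mul]
      -- Multiplication in `Aut` composes from right to left: in `b * c` the braid `c` is at the
      -- bottom.
      have e := (alexTQFT t).map_comp (braidAut n c).hom (braidAut n b).hom
      have e' := (alexTQFT t).map_comp (braidAut n b).inv (braidAut n c).inv
      exact ⟨e ▸ hc.1.comp hb.1, e' ▸ hb.2.comp hc.2⟩
    | inv b hb =>
      rw [map_inv]
      exact ⟨hb.2, hb.1⟩
    | gen k hk =>
      rw [braidAut_σ hk]
      -- The generator is a single positive crossing, its inverse a single negative one.
      exact ⟨isBasic_ofDiagram t ⟨trivial, Or.inl rfl⟩, isBasic_ofDiagram t ⟨trivial, Or.inr rfl⟩⟩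
  rintro ⟨_⟩ ⟨_⟩ ⟨b⟩
  exact (key _ b).1

/-! ### The functor to vector spaces and its uniqueness -/

theorem factorBasic_comp_basicSpan {C : Type} [Category.{0} C] (G : C ⥤ SpanVect)
    (h : ∀ {a b : C} (f : a ⟶ b), IsBasic (G.map f)) : factorBasic G h ⋙ basicSpan = G :=
  CategoryTheory.Functor.hext (fun _ => rfl) fun _ _ f => heq_of_eq (h f).choose_spec.symm

/-- `basicSpan` is injective on objects and faithful, hence can be cancelled. This is the uniqueness
of the restricted functor. -/
theorem comp_basicSpan_injective {C : Type} [Category.{0} C] {F G : C ⥤ FGModuleCat.{0} ℂ}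
    (h : F ⋙ basicSpan = G ⋙ basicSpan) : F = G := by
  have hobj : ∀ a, F.obj a = G.obj a := fun a =>
    congrArg SpanVect.space (CategoryTheory.Functor.congr_obj h a)
  -- `F.map f` and `G.map f` have different types until the objects are identified, so faithfulness
  -- is restated for heterogeneous equality.
  have key : ∀ {V W V' W' : FGModuleCat.{0} ℂ} (f : V ⟶ W) (g : V' ⟶ W'), V = V' → W = W' →
      HEq (basicSpan.map f) (basicSpan.map g) → HEq f g := by
    rintro V W _ _ f g rfl rfl h
    exact heq_of_eq (basicSpan_injective (eq_of_heq h))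
  refine CategoryTheory.Functor.hext hobj fun a b f => key _ _ (hobj a) (hobj b) ?_
  have : ∀ {H K : C ⥤ SpanVect}, H = K → HEq (H.map f) (K.map f) := by
    rintro H _ rfl
    rfl
  exact this h

/-! ### The representation of the braid group -/

noncomputable section

variable (t : ℂˣ) (h : BraidsBasic t)

/-- The linear maps of braids, as a representation of the braid group. -/
def braidEnd (n : ℕ) : BraidGroup n →* Module.End ℂ (Fin n → ℂ) where
  toFun b := braidMap t h (BraidCat.ofGroup b)
  map_one' := braidMap_id t h n
  map_mul' b c := braidMap_comp t h (BraidCat.ofGroup c) (BraidCat.ofGroup b)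

/-- `coord` differs from `evalEquiv` only by renaming the index set `Fin (List.replicate n
pos).length` to `Fin n`. As lists of entries the two agree, which keeps casts out of the color
relations. -/
theorem ofFn_coord (n : ℕ) (x : boundaryRep t (List.replicate n pos)) :
    List.ofFn (coord t n x) = List.ofFn (evalEquiv t _ x) := by
  have : ∀ {k l : ℕ} (e : k = l) (f : Fin k → ℂ),
      List.ofFn (fun i : Fin l => f (Fin.cast e.symm i)) = List.ofFn f := by
    rintro k _ rfl f
    rfl
  exact this List.length_replicate (evalEquiv t _ x)

/-- `braidMap` rests on a choice of linear maps, so its values are not visible by unfolding. This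
lemma makes them computable: any diagram of the tangle of `b` may be used, and the pair of bottom
and top colors satisfies its relation. -/
theorem lrel_braidMap {m n : ℕ} (b : (⟨m⟩ : BraidCat) ⟶ ⟨n⟩)
    (D : Diagram (List.replicate m pos) (List.replicate n pos))
    (hD : BraidHom.toTangle b = Tangle.ofDiagram D) (x : Fin m → ℂ) :
    LRel t D (List.ofFn x) (List.ofFn (braidMap t h b x)) := by
  have hb : LinSpan.Equiv (alexSpan t D) (LinSpan.basic ((braidTQFT t h).map b).hom.hom) := by
    refine SpanVect.equiv_of_ofSpan_eq (U := ⟨boundaryRep t (List.replicate m pos)⟩)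
      (V := ⟨boundaryRep t (List.replicate n pos)⟩) (Eq.trans ?_ (h b).choose_spec)
    exact (congrArg (alexTQFT t).map hD).symm
  have := lrel_of_basic t D _ hb ((coord t m).symm x)
  rw [← ofFn_coord, ← ofFn_coord, LinearEquiv.apply_symm_apply] at this
  exact this

/-- The generator `k` of the braid group exchanges the entries `k` and `k + 1`. -/
theorem braidEnd_σ {n k : ℕ} (hk : k + 1 < n) (x : Fin n → ℂ) :
    braidEnd t h n (BraidGroup.σ n k) x = fun i =>
      if i.val = k then t * x ⟨k + 1, hk⟩ + (1 - t) * x ⟨k, by omega⟩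
      else if i.val = k + 1 then x ⟨k, by omega⟩ else x i := by
  have H := lrel_braidMap t h (BraidCat.ofGroup (BraidGroup.σ n k)) _
    (congrArg Iso.hom (braidAut_σ hk)) x
  change LRel t _ _ (List.ofFn (braidEnd t h n (BraidGroup.σ n k) x)) at H
  -- The diagram has one slice, so its relation unfolds completely: `x` is `u ++ [a, b] ++ v` with
  -- `u` of length `k`, and the image is the same list with the crossing rule applied to `[a, b]`.
  obtain ⟨_, ⟨-, rfl⟩, u, m, m', v, hu, hv, ⟨a, b, rfl, rfl⟩, e, e'⟩ := H
  simp only [List.length_replicate] at hu hv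
  have hx : ∀ i : Fin n, (u ++ [a, b] ++ v)[i.val]? = some (x i) := by
    intro i
    rw [← e]
    simp
  funext i
  have hy : (u ++ [t * b + (1 - t) * a, a] ++ v)[i.val]? =
      some (braidEnd t h n (BraidGroup.σ n k) x i) := by
    rw [← e']
    simp
  have h0 := hx ⟨k, by omega⟩
  have h1 := hx ⟨k + 1, hk⟩
  have h2 := hx i
  clear e e'
  grind

theorem isBurau_braidRep (n : ℕ) : IsBurau t (braidRep t h n) := by
  intro k hk
  ext i j
  change LinearMap.toMatrix' (braidEnd t h n (BraidGroup.σ n k)) i j = _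
  -- Column `j` is the image of the `j`-th standard basis vector.
  rw [LinearMap.toMatrix'_apply, braidEnd_σ t h hk]
  simp only [burauMatrix, Pi.single_apply, Fin.ext_iff]
  split_ifs <;> first | omega | simp

/-! ### Juxtaposition -/

theorem braidEnd_inv_apply {n : ℕ} (b : BraidGroup n) (x : Fin n → ℂ) :
    braidEnd t h n b (braidEnd t h n b⁻¹ x) = x := by
  rw [← Module.End.mul_apply, ← map_mul, mul_inv_cancel, map_one, Module.End.one_apply]

theorem braidEnd_inv_apply' {n : ℕ} (b : BraidGroup n) (x : Fin n → ℂ) :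
    braidEnd t h n b⁻¹ (braidEnd t h n b x) = x := by
  rw [← Module.End.mul_apply, ← map_mul, inv_mul_cancel, map_one, Module.End.one_apply]

/-- Quantified over all `x`, the claim is compatible with products and inverses of braids, so
generators suffice. The generator `k` keeps its index in the larger group and touches only the
positions `k` and `k + 1`, which lie in the first block. -/
theorem braidEnd_inclLeft {m n : ℕ} (b : BraidGroup m) (x : Fin m → ℂ) (y : Fin n → ℂ) :
    braidEnd t h (m + n) (BraidGroup.inclLeft m n b) (Fin.append x y) =
      Fin.append (braidEnd t h m b x) y := by
  induction b using BraidGroup.induction generalizing x with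
  | one => simp
  | mul b c hb hc => simp only [map_mul, Module.End.mul_apply, hb, hc]
  | inv b hb =>
    -- The hypothesis for `b` at the vector `b⁻¹ x` is the claim for `b⁻¹` with the map of `b`
    -- applied to both sides.
    have e := hb (braidEnd t h m b⁻¹ x)
    rw [braidEnd_inv_apply] at e
    rw [← e, map_inv, braidEnd_inv_apply']
  | gen k hk =>
    have e : BraidGroup.inclLeft m n (BraidGroup.σ m k) = BraidGroup.σ (m + n) k :=
      BraidGroup.lift_σ _ _ _ (by omega)
    have e0 : Fin.append x y ⟨k, by omega⟩ = x ⟨k, by omega⟩ := Fin.append_left x y ⟨k, _⟩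
    have e1 : Fin.append x y ⟨k + 1, by omega⟩ = x ⟨k + 1, hk⟩ := Fin.append_left x y ⟨k + 1, hk⟩
    rw [e, braidEnd_σ t h hk, braidEnd_σ t h (by omega), e0, e1]
    funext i
    refine Fin.addCases (fun i => ?_) (fun i => ?_) i
    · simp
    · have : m + i.val ≠ k := by omega
      have : m + i.val ≠ k + 1 := by omega
      simp [*]

/-- The same induction, with the index of each generator shifted by `m` into the second block. -/
theorem braidEnd_inclRight {m n : ℕ} (b : BraidGroup n) (x : Fin m → ℂ) (y : Fin n → ℂ) :
    braidEnd t h (m + n) (BraidGroup.inclRight m n b) (Fin.append x y) =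
      Fin.append x (braidEnd t h n b y) := by
  induction b using BraidGroup.induction generalizing y with
  | one => simp
  | mul b c hb hc => simp only [map_mul, Module.End.mul_apply, hb, hc]
  | inv b hb =>
    have e := hb (braidEnd t h n b⁻¹ y)
    rw [braidEnd_inv_apply] at e
    rw [← e, map_inv, braidEnd_inv_apply']
  | gen k hk =>
    have e : BraidGroup.inclRight m n (BraidGroup.σ n k) = BraidGroup.σ (m + n) (m + k) :=
      BraidGroup.lift_σ _ _ _ (by omega)
    have e0 : Fin.append x y ⟨m + k, by omega⟩ = y ⟨k, by omega⟩ := Fin.append_right x y ⟨k, _⟩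
    have e1 : Fin.append x y ⟨m + k + 1, by omega⟩ = y ⟨k + 1, hk⟩ :=
      Fin.append_right x y ⟨k + 1, hk⟩
    rw [e, braidEnd_σ t h hk, braidEnd_σ t h (by omega), e0, e1]
    funext i
    refine Fin.addCases (fun i => ?_) (fun i => ?_) i
    · have : i.val ≠ m + k := by omega
      have : i.val ≠ m + k + 1 := by omega
      simp [*]
    · simp [add_assoc]

theorem braidMap_tensor {m n m' n' : ℕ} (b : (⟨m⟩ : BraidCat) ⟶ ⟨n⟩)
    (b' : (⟨m'⟩ : BraidCat) ⟶ ⟨n'⟩) (x : Fin m → ℂ) (x' : Fin m' → ℂ) :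
    braidMap t h (BraidCat.tensor b b') (Fin.append x x') =
      Fin.append (braidMap t h b x) (braidMap t h b' x') := by
  change BraidHom m n at b
  change BraidHom m' n' at b'
  obtain ⟨b⟩ := b
  obtain ⟨b'⟩ := b'
  change braidEnd t h _ (BraidGroup.inclLeft m m' b * BraidGroup.inclRight m m' b') _ =
    Fin.append (braidEnd t h m b x) (braidEnd t h m' b' x')
  rw [map_mul, Module.End.mul_apply, braidEnd_inclRight, braidEnd_inclLeft]

/-! ### The braiding -/

/-- The extension of a vector by zero. -/
def extendZero {n : ℕ} (x : Fin n → ℂ) (i : ℕ) : ℂ := if hi : i < n then x ⟨i, hi⟩ else 0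

/-- Indexing by ℕ lets the inductions below compare positions by arithmetic alone. A crossing reads
only the positions `k` and `k + 1`, both below `n`, so the zeros outside never enter its formula. -/
theorem extendZero_σ {n k : ℕ} (hk : k + 1 < n) (x : Fin n → ℂ) :
    extendZero (braidEnd t h n (BraidGroup.σ n k) x) = fun i =>
      if i = k then t * extendZero x (k + 1) + (1 - t) * extendZero x k
      else if i = k + 1 then extendZero x k else extendZero x i := by
  funext i
  rw [braidEnd_σ t h hk]
  simp only [extendZero]
  split_ifs <;> first | rfl | omega

/-- One strand passes over `n` strands. -/
theorem extendZero_strand {N i n : ℕ} (hN : n = 0 ∨ i + n < N) (x : Fin N → ℂ) :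
    extendZero (braidEnd t h N
        (((List.range n).reverse.map fun j => BraidGroup.σ N (i + j)).prod) x) = fun p =>
      if p < i then extendZero x p
      else if p < i + n then t * extendZero x (p + 1) + (1 - t) * extendZero x i
      else if p = i + n then extendZero x i else extendZero x p := by
  induction n with
  | zero =>
    funext p
    simp only [List.range_zero, List.reverse_nil, List.map_nil, List.prod_nil, map_one,
      Module.End.one_apply]
    grind
  | succ n ih =>
    -- Because the list is reversed, the new factor is leftmost and acts last: after `n` crossings
    -- the over-strand sits at position `i + n` with its color unchanged, and it crosses one more
    -- strand.
    rw [List.range_succ, List.reverse_append, List.reverse_singleton, List.singleton_append,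
      List.map_cons, List.prod_cons, map_mul, Module.End.mul_apply,
      extendZero_σ t h (by omega), ih (by omega)]
    funext p
    grind

/-- The rightmost factor acts first, so the last strand of the bundle is the first to cross. Once it
has crossed, a bundle of `m` strands remains, which meets the colors t b + (1 - t) aₘ instead of b;
the product tᵐ (t b + (1 - t) aₘ) supplies both the new summand and the power tᵐ⁺¹. -/
theorem extendZero_bundle {N n m : ℕ} (hN : m + n ≤ N) (x : Fin N → ℂ) :
    extendZero (braidEnd t h N (((List.range m).map fun i =>
        ((List.range n).reverse.map fun j => BraidGroup.σ N (i + j)).prod).prod) x) = fun p =>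
      if p < n then (∑ i ∈ Finset.range m, (1 - (t : ℂ)) * (t : ℂ) ^ i * extendZero x i) +
        (t : ℂ) ^ m * extendZero x (m + p)
      else if p < n + m then extendZero x (p - n) else extendZero x p := by
  induction m generalizing x with
  | zero =>
    funext p
    simp
    grind
  | succ m ih =>
    rw [List.range_succ, List.map_append, List.prod_append, List.map_singleton,
      List.prod_singleton, map_mul, Module.End.mul_apply, ih (by omega),
      extendZero_strand t h (by omega)]
    funext p
    -- The strand at position `m` has not moved anything to its left, so the sum for the remaining
    -- bundle is still taken over the original colors.
    have hs : (∑ i ∈ Finset.range m, (1 - (t : ℂ)) * (t : ℂ) ^ i *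
        (if i < m then extendZero x i
          else if i < m + n then t * extendZero x (i + 1) + (1 - t) * extendZero x m
          else if i = m + n then extendZero x m else extendZero x i)) =
        ∑ i ∈ Finset.range m, (1 - (t : ℂ)) * (t : ℂ) ^ i * extendZero x i :=
      Finset.sum_congr rfl fun i hi => by rw [if_pos (Finset.mem_range.1 hi)]
    simp only [hs, Finset.sum_range_succ]
    by_cases h1 : p < n
    · rw [if_pos h1, if_pos h1, if_neg (by omega), if_pos (by omega),
        show m + p + 1 = m + 1 + p by omega]
      ring
    · rw [if_neg h1, if_neg h1]
      grind

/-- Needed because `BraidCat.braiding` ends with the identification of `m + n` with `n + m`, which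
only renames indices. -/
theorem braidMap_eqToHom {m n : ℕ} (e : m = n) (x : Fin m → ℂ) :
    braidMap t h (eqToHom (congrArg BraidCat.mk e)) x = x ∘ Fin.cast e.symm := by
  subst e
  exact congrArg (fun f => f x) (braidMap_id t h m)

theorem braidMap_braiding (m n : ℕ) (x : Fin m → ℂ) (y : Fin n → ℂ) :
    braidMap t h (BraidCat.braiding m n) (Fin.append x y) =
      Fin.append (fun j => (∑ i : Fin m, (1 - (t : ℂ)) * (t : ℂ) ^ i.val * x i) +
        (t : ℂ) ^ m * y j) x := by
  rw [BraidCat.braiding, braidMap_comp, LinearMap.comp_apply,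
    braidMap_eqToHom t h (Nat.add_comm m n)]
  have hx : ∀ i : Fin m, extendZero (Fin.append x y) i = x i := fun i => by
    rw [extendZero, dif_pos (by omega)]
    exact Fin.append_left x y i
  have hy : ∀ j : Fin n, extendZero (Fin.append x y) (m + j) = y j := fun j => by
    rw [extendZero, dif_pos (by omega)]
    exact Fin.append_right x y j
  -- The two bundles fill all `m + n` positions, so the third case of the formula does not occur.
  have key := extendZero_bundle t h (le_refl (m + n)) (Fin.append x y)
  have eval : ∀ p : Fin (n + m),
      braidMap t h (BraidCat.ofGroup (BraidGroup.shuffle m n)) (Fin.append x y)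
        (Fin.cast (Nat.add_comm n m) p) = _ := fun p => by
    refine Eq.trans ?_ (congrFun key p.val)
    rw [extendZero, dif_pos (by omega)]
    rfl
  funext p
  refine (eval p).trans ?_
  refine Fin.addCases (fun j => ?_) (fun i => ?_) p
  · simp only [Fin.val_castAdd, j.isLt, if_true, Fin.append_left, hy, Finset.sum_range, hx]
  · simp [hx]

/-- `IsBraiding` introduces `y₁` and `x₁` only through an equation β(x, y) = (y₁, x₁). Solving it
turns naturality and the hexagons into identities between explicit vectors. -/
theorem braidMap_braiding_iff (m n : ℕ) (x x₁ : Fin m → ℂ) (y y₁ : Fin n → ℂ) :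
    braidMap t h (BraidCat.braiding m n) (Fin.append x y) = Fin.append y₁ x₁ ↔
      y₁ = (fun j => (∑ i : Fin m, (1 - (t : ℂ)) * (t : ℂ) ^ i.val * x i) + (t : ℂ) ^ m * y j) ∧
        x₁ = x := by
  rw [braidMap_braiding]
  refine ⟨fun e => ⟨?_, ?_⟩, ?_⟩
  · funext j
    simpa using (congrFun e (Fin.castAdd m j)).symm
  · funext i
    simpa using (congrFun e (Fin.natAdd n i)).symm
  · rintro ⟨rfl, rfl⟩
    rfl

theorem braidMap_bijective {m n : ℕ} (b : (⟨m⟩ : BraidCat) ⟶ ⟨n⟩) :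
    Function.Bijective (braidMap t h b) := by
  change BraidHom m n at b
  obtain ⟨b⟩ := b
  exact Function.bijective_iff_has_inverse.2
    ⟨braidEnd t h m b⁻¹, braidEnd_inv_apply' t h b, braidEnd_inv_apply t h b⟩

/-- Braids preserve the linear form `∑ tⁱ xᵢ`. -/
theorem sum_braidEnd {n : ℕ} (b : BraidGroup n) (x : Fin n → ℂ) :
    ∑ i, (t : ℂ) ^ i.val * braidEnd t h n b x i = ∑ i, (t : ℂ) ^ i.val * x i := by
  induction b using BraidGroup.induction generalizing x with
  | one => simp
  | mul b c hb hc => rw [map_mul, Module.End.mul_apply, hb, hc]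
  | inv b hb => rw [← hb, braidEnd_inv_apply]
  | gen k hk =>
    -- Only the terms at `k` and `k + 1` change, and with a = x_k, b = x_{k+1} their sum is
    -- preserved: tᵏ (t b + (1 - t) a) + tᵏ⁺¹ a = tᵏ a + tᵏ⁺¹ b.
    rw [braidEnd_σ t h hk, ← sub_eq_zero, ← Finset.sum_sub_distrib,
      Fintype.sum_eq_add (⟨k, by omega⟩ : Fin n) ⟨k + 1, hk⟩ (by simp [Fin.ext_iff])]
    · simp
      ring
    · rintro i ⟨h1, h2⟩
      dsimp only
      rw [if_neg (fun e => h1 (Fin.ext e)), if_neg (fun e => h2 (Fin.ext e)), sub_self]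

/-- Braids fix the constant vectors. -/
theorem braidEnd_const {n : ℕ} (b : BraidGroup n) (c : ℂ) :
    braidEnd t h n b (fun _ => c) = fun _ => c := by
  induction b using BraidGroup.induction with
  | one => simp
  | mul b d hb hd => rw [map_mul, Module.End.mul_apply, hd, hb]
  | inv b hb =>
    -- The constant vector stands on both sides; only the one on the left is to be replaced by its
    -- image under `b`.
    conv_lhs => rw [← hb]
    rw [braidEnd_inv_apply']
  | gen k hk =>
    rw [braidEnd_σ t h hk]
    funext i
    -- t c + (1 - t) c = c, the idempotence of the quandle.
    split_ifs <;> ring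

/-- In the notation β(x, y) = ((1 - t) ℓ(x) 𝟙 + tᵐ y, x), the first bundle is unchanged throughout,
so each identity only has to be checked on the strands that pass underneath. -/
theorem isBraiding_braidMap :
    IsBraiding (braidMap t h) (fun m n => braidMap t h (BraidCat.braiding m n)) where
  bijective m n := braidMap_bijective t h _
  natural := by
    intro m m' n n' b c x x₁ y y₁ e
    change BraidHom m m' at b
    change BraidHom n n' at c
    obtain ⟨b⟩ := b
    obtain ⟨c⟩ := c
    obtain ⟨rfl, rfl⟩ := (braidMap_braiding_iff t h _ _ _ _ _ _).1 e
    refine (braidMap_braiding_iff t h _ _ _ _ _ _).2 ⟨?_, rfl⟩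
    change braidEnd t h n c _ = fun j => (∑ i : Fin m, (1 - (t : ℂ)) * (t : ℂ) ^ i.val *
      braidEnd t h m b x₁ i) + (t : ℂ) ^ m * braidEnd t h n c y j
    -- The braid `b` enters the lower strands only through ℓ(b x), which equals ℓ(x).
    simp only [mul_assoc, ← Finset.mul_sum, sum_braidEnd]
    -- What remains is linearity of `c` together with the fact that it fixes the constant vector (1
    -- - t) ℓ(x) 𝟙.
    exact (map_add (braidEnd t h n c) (fun _ => _) ((t : ℂ) ^ m • y)).trans
      (congrArg₂ (· + ·) (braidEnd_const t h c _) (map_smul _ _ _))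
  hexagon_right := by
    intro m n k x x₁ x₂ y y₁ z z₁ e e'
    obtain ⟨rfl, rfl⟩ := (braidMap_braiding_iff t h _ _ _ _ _ _).1 e
    obtain ⟨rfl, rfl⟩ := (braidMap_braiding_iff t h _ _ _ _ _ _).1 e'
    refine (braidMap_braiding_iff t h _ _ _ _ _ _).2 ⟨?_, rfl⟩
    funext j
    -- The entries of `y` and of `z` undergo the same affine map, which depends on `x` alone.
    refine Fin.addCases (fun j => ?_) (fun j => ?_) j <;> simp
  hexagon_left := by
    intro m n k x x₁ y y₁ z z₁ z₂ e e'
    obtain ⟨rfl, rfl⟩ := (braidMap_braiding_iff t h _ _ _ _ _ _).1 e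
    obtain ⟨rfl, rfl⟩ := (braidMap_braiding_iff t h _ _ _ _ _ _).1 e'
    refine (braidMap_braiding_iff t h _ _ _ _ _ _).2 ⟨?_, rfl⟩
    funext j
    -- The form ℓ on the joint bundle splits as ℓ(x) + tᵐ ℓ(y), so both sides are (1 - t) ℓ(x) + tᵐ
    -- ((1 - t) ℓ(y) + tⁿ z) in each entry.
    simp only [Fin.sum_univ_add, Fin.append_left, Fin.append_right, Fin.val_castAdd,
      Fin.val_natAdd, mul_add, Finset.mul_sum, pow_add, add_assoc]
    congr 1
    rw [← mul_assoc]
    congr 1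
    exact Finset.sum_congr rfl fun i _ => by ring

end

end TangleTQFT

/-! ### Assembly of the theorem -/

theorem mainTheorem9 (t : ℂˣ) :
    (∀ (m n : ℕ) (T : plus m ⟶ plus n), IsBraid T → IsBasic ((alexTQFT t).map T)) ∧
    ∃ h : BraidsBasic t,
      (braidTQFT t h ⋙ basicSpan = braidIncl ⋙ alexTQFT t ∧
        ∀ F : BraidCat ⥤ FGModuleCat.{0} ℂ,
          F ⋙ basicSpan = braidIncl ⋙ alexTQFT t → F = braidTQFT t h) ∧
      (∀ n : ℕ, IsBurau t (braidRep t h n)) ∧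
      (∀ (m n m' n' : ℕ) (b : (⟨m⟩ : BraidCat) ⟶ ⟨n⟩) (b' : (⟨m'⟩ : BraidCat) ⟶ ⟨n'⟩)
        (x : Fin m → ℂ) (x' : Fin m' → ℂ),
          braidMap t h (BraidCat.tensor b b') (Fin.append x x') =
            Fin.append (braidMap t h b x) (braidMap t h b' x')) ∧
      (∀ (m n : ℕ) (x : Fin m → ℂ) (y : Fin n → ℂ),
        braidMap t h (BraidCat.braiding m n) (Fin.append x y) =
          Fin.append (fun j => (∑ i : Fin m, (1 - (t : ℂ)) * (t : ℂ) ^ i.val * x i) +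
            (t : ℂ) ^ m * y j) x) ∧
      IsBraiding (braidMap t h) (fun m n => braidMap t h (BraidCat.braiding m n)) := by
  have h : BraidsBasic t := braidsBasic t
  have hc : braidTQFT t h ⋙ basicSpan = braidIncl ⋙ alexTQFT t := factorBasic_comp_basicSpan _ h
  exact ⟨fun _ _ _ hT => isBasic_of_isBraid t hT, h,
    ⟨hc, fun _ hF => comp_basicSpan_injective (hF.trans hc.symm)⟩,
    fun n => isBurau_braidRep t h n, fun _ _ _ _ b b' => braidMap_tensor t h b b',
    braidMap_braiding t h, isBraiding_braidMap t h⟩
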